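/- **Model.** Fix constants $P,R>0$, $0<\epsilon<1$, $1\le\lambda<\zeta$, $0\le r_{\min}\le\epsilon R/4$, $C$, $\mathcal I_{cd}>0$, $\phi_0\ge 1$, $h_1,h_2>1$, and functions $\rho_c\ge 0$, $\mathcal I_c>0$, $\mathcal I_{ack}>0$ of a precision $\delta$. A *static network* is a finite node set $V$ with a path loss $f:V\times V\to(0,\infty)$ such that $f(u,v)^{1/\zeta}\le f(u,w)^{1/\zeta}+f(w,v)^{1/\zeta}$ for all $u,v,w$. Put $d(u,v)=f(u,v)^{1/\zeta}$ for $u\ne v$, $d(u,u)=0$, and let $B(u,r)=\{v:\max(d(u,v),d(v,u))<r\}$, $D(u,r)=\{v:d(v,u)<r\}$, $D_u^\rho=D(u,\rho R)$, $N(u,\delta)=\{v:d(u,v)\le(1-\delta)R\}$, $\mathcal I_{uv}=P/f(u,v)$. It is assumed that $(V,d)$ has $(r_{\min},\lambda)$-bounded independence: for all $q\ge1$ and $u\in V$, every set $S\subseteq V$ whose balls $B(x,r_{\min})$, $x\in S$, are pairwise disjoint and contained in $D(u,q\,r_{\min})$ has at most $Cq^\lambda$ elements. The *communication graph* $G$ is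 the directed graph with an edge from $u$ to $v$ iff $v\in N(u,\epsilon)$; $dist_G(s,v)$ is the number of edges of a shortest directed path from $s$ to $v$, and $D_G$ is the largest such distance. **Communication and primitives.** Rounds are synchronous and have two slots. Let $S$ be the set of transmitters in a slot. Only transmissions of nodes of $S$ are received, by nodes other than the transmitter. *SuccClear*($\delta$): if $u\in S$, no other node of $D_u^{\rho_c(\delta)}$ is in $S$, and $\sum_{v\in S\setminus\{u\}}\mathcal I_{vu}\le\mathcal I_c(\delta)$, then all nodes of $N(u,\delta)\setminus\{u\}$ receive the transmission of $u$; all other receptions are under adversarial control. *ACK*($\delta$): for a transmitting node $u$ the outcome is $1$ if all of $N(u,\delta)\setminus\{u\}$ receive its transmission and the interference at $u$ is at most $\mathcal I_{ack}(\delta)$; it is $0$ if some node of $N(u,\delta)\setminus\{u\}$ does not receive it; otherwise it is adversarial. *NTD*: the outcome is $1$ at $v$ iff $v$ receives a transmission from some $u\in D_v^{\epsilon/2}$. *CD* (first slot; each node detects Busy or Idle), with vicinity parameter $\rho>1$: if the nodes use transmission probabilities $p(\cdot)$ in a round, then, conditionally on the past, (i) for every $v$ and every $\phi>\phi_0$ with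 $\sum_{w\in B(v,R/2)}p(w)>\phi$, all nodes of $B(v,R/2)$ detect Busy with probability at least $1-h_1^{-\phi}$; (ii) for every $v$ and every $\eta>0$ with $\sum_{w\in D_v^\rho}p(w)\le\eta$, given that the interference at $v$ from transmitters outside $D_v^\rho$ is less than $\mathcal I_{cd}$, $v$ detects Idle with probability at least $h_2^{-\eta}$. Everything not determined by these rules is chosen, possibly at random, by an adaptive adversary. **Algorithm Bcast\*.** The nodes know a number $n\ge|V|$ (for example $n=|V|$). Initially only the source $s$ has the message. A node that has the message starts with transmission probability $p=\frac12n^{-1}$ (the source in the first round, any other node in the round after the one in which it first receives the message in either slot), and until it stops it does the following in each round. In the first slot it transmits the message with probability $p$, independently of the other nodes in that round. If it transmitted and detects ACK($\epsilon/2$), it retransmits in the second slot and then stops forever. Otherwise $p$ becomes $\max\{p/2,n^{-1}\}$ if it detected Busy and $\min\{2p,1/2\}$ if it detected Idle. Moreover, any node, also one that gets the message only in this round, stops forever if it receives a message in the first slot and detects NTD in the second slot. SuccClear($\epsilon/2$) holds in both slots. Nodes without the message and stopped nodes do not transmit. **Corollary.** For every choice of the constants of the model there is $\rho_0>1$ such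 that for every $\rho\ge\rho_0$ and every $k>0$ there is a constant $K>0$ (depending only on the constants of the model, $\rho$ and $k$) such that for every static network, every $n\ge|V|$, every source $s\in V$, and every execution of Bcast\* with CD of vicinity parameter $\rho$ against an adaptive adversary: 1. for each node $v$ that is reachable from $s$ in $G$ and each number of rounds $t\ge K\log n\cdot dist_G(s,v)$, node $v$ has received the message within the first $t$ rounds with probability at least $1-n^{-k}$; 2. if $G$ is strongly connected, then for each $t\ge K\log n\cdot D_G$, all nodes have received the message within the first $t$ rounds with probability at least $1-n^{-k}$. -/

import Mathlib

namespace Wireless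

noncomputable section

/-! # The radio model -/

/-- The constants of the wireless model.  The functions `rhoc`, `Ic`, `Iack` give the parameters of
`SuccClear` and `ACK` as functions of the precision at which they are used. -/
structure Model where
  /-- uniform transmission power -/
  P : ℝ
  P_pos : 0 < P
  /-- maximum transmission distance -/
  R : ℝ
  R_pos : 0 < R
  /-- precision parameter; the communication radius is `(1 - ε) R` -/
  ε : ℝ
  ε_pos : 0 < ε
  ε_lt_one : ε < 1
  /-- bound on the metricity -/
  ζ : ℝ
  /-- growth exponent of the bounded independence property -/
  growth : ℝ
  one_le_growth : 1 ≤ growth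
  growth_lt_ζ : growth < ζ
  /-- scale of the bounded independence property -/
  rmin : ℝ
  rmin_nonneg : 0 ≤ rmin
  rmin_le : rmin ≤ ε * R / 4
  /-- multiplicative constant of the bounded independence property -/
  C : ℝ
  /-- `SuccClear`: relative radius that has to be free of other transmitters -/
  rhoc : ℝ → ℝ
  rhoc_nonneg : ∀ δ, 0 ≤ rhoc δ
  /-- `SuccClear`: interference threshold -/
  Ic : ℝ → ℝ
  Ic_pos : ∀ δ, 0 < Ic δ
  /-- `ACK`: interference threshold -/
  Iack : ℝ → ℝ
  Iack_pos : ∀ δ, 0 < Iack δ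
  /-- `CD`: interference threshold -/
  Icd : ℝ
  Icd_pos : 0 < Icd
  /-- `CD`: contention above which the busy guarantee starts to hold -/
  phi0 : ℝ
  one_le_phi0 : 1 ≤ phi0
  /-- `CD`: base of the error probability of the busy guarantee -/
  h1 : ℝ
  one_lt_h1 : 1 < h1
  /-- `CD`: base of the success probability of the idle guarantee -/
  h2 : ℝ
  one_lt_h2 : 1 < h2

section Geometry

variable {V : Type*}

open Classical in
/-- The quasi-distance `d(u,v) = f(u,v)^{1/ζ}` for `u ≠ v`, and `d(u,u) = 0`, of a path loss
`f`. -/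
def qdist (ζ : ℝ) (f : V → V → ℝ) (u v : V) : ℝ :=
  if u = v then 0 else f u v ^ (1 / ζ)

/-- The ball `B(u,r) = {v | max {d(v,u), d(u,v)} < r}`. -/
def ball (d : V → V → ℝ) (u : V) (r : ℝ) : Set V := {v | max (d v u) (d u v) < r}

/-- The in-ball `D(u,r) = {v | d(v,u) < r}`. -/
def inBall (d : V → V → ℝ) (u : V) (r : ℝ) : Set V := {v | d v u < r}

/-- `S` is an `r`-packing for `S'`. -/
def IsPacking (d : V → V → ℝ) (r : ℝ) (S : Finset V) (S' : Set V) : Prop :=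
  (∀ u ∈ S, ball d u r ⊆ S') ∧
    ∀ u ∈ S, ∀ v ∈ S, u ≠ v → Disjoint (ball d u r) (ball d v r)

/-- `(r, growth)`-bounded independence with multiplicative constant `C`. -/
def BoundedIndependence (d : V → V → ℝ) (r growth C : ℝ) : Prop :=
  ∀ q : ℝ, 1 ≤ q → ∀ u : V, ∀ S : Finset V,
    IsPacking d r S (inBall d u (q * r)) → (S.card : ℝ) ≤ C * q ^ growth

end Geometry

/-- A static network on the node set `V`: a path loss of metricity at most `ζ` whose quasi-metric
has bounded independence. -/
structure Network (M : Model) (V : Type*) where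
  /-- path loss from the first to the second node -/
  f : V → V → ℝ
  f_pos : ∀ u v, 0 < f u v
  metricity : ∀ u v w, f u v ^ (1 / M.ζ) ≤ f u w ^ (1 / M.ζ) + f w v ^ (1 / M.ζ)
  independence : BoundedIndependence (qdist M.ζ f) M.rmin M.growth M.C

namespace Network

variable {M : Model} {V : Type*} (N : Network M V)

/-- The quasi-metric of the network. -/
def d (u v : V) : ℝ := qdist M.ζ N.f u v

/-- The neighbourhood `N(u, δ) = {v | d(u,v) ≤ (1 - δ) R}` at precision `δ`. -/
def nbhd (u : V) (δ : ℝ) : Set V := {v | N.d u v ≤ (1 - δ) * M.R}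

/-- The vicinity `D_u^ρ = D(u, ρ R)`. -/
def vicinity (u : V) (ρ : ℝ) : Set V := inBall N.d u (ρ * M.R)

/-- The directed communication graph: `u → v` is an edge iff `v ∈ N(u, ε)`. -/
def commGraph : Digraph V where
  Adj u v := v ∈ N.nbhd u M.ε

/-- The strength at `v` of the signal of `u`. -/
def signal (u v : V) : ℝ := M.P / N.f u v

open Classical in
/-- The total interference at `u` from the other nodes of `S`. -/
def interference (S : Finset V) (u : V) : ℝ := ∑ v ∈ S with v ≠ u, N.signal v u

open Classical in
/-- The interference at `v` from the nodes of `S` outside of the vicinity `D_v^ρ`. -/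
def farInterference (ρ : ℝ) (S : Finset V) (v : V) : ℝ :=
  ∑ w ∈ S with w ∉ N.vicinity v ρ, N.signal w v

open Classical in
/-- The contention `P(v) = ∑_{w ∈ B(v, R/2)} p(w)` in the close neighbourhood of `v`. -/
def closeContention [Fintype V] (p : V → ℝ) (v : V) : ℝ :=
  ∑ w with w ∈ ball N.d v (M.R / 2), p w

open Classical in
/-- The contention `P^ρ(v) = ∑_{w ∈ D_v^ρ} p(w)` in the vicinity of `v`. -/
def vicinityContention [Fintype V] (ρ : ℝ) (p : V → ℝ) (v : V) : ℝ :=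
  ∑ w with w ∈ N.vicinity v ρ, p w

end Network

/-! # Hop distance -/

section Hops

variable {V : Type*} (G : Digraph V)

/-- `HasWalk G k u v`: there is a directed walk with exactly `k` edges from `u` to `v`. -/
inductive HasWalk : ℕ → V → V → Prop
  | nil (u : V) : HasWalk 0 u u
  | snoc {k : ℕ} {u v w : V} : HasWalk k u v → G.Adj v w → HasWalk (k + 1) u w

/-- The number of edges of a shortest directed path from `u` to `v` (`⊤` if there is none). -/
def hopDist (u v : V) : ℕ∞ := ⨅ (k : ℕ) (_ : HasWalk G k u v), (k : ℕ∞)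

/-- The diameter, the largest hop distance between two nodes. -/
def diameter : ℕ∞ := ⨆ (u : V) (v : V), hopDist G u v

/-- Every node can be reached from every node. -/
def StronglyConnected : Prop := ∀ u v : V, ∃ k, HasWalk G k u v

end Hops

/-! # The algorithm Bcast* -/

/-- Everything that happens in one round. -/
structure Outcome (V : Type*) where
  /-- the nodes that transmit in the first slot -/
  tx : Finset V
  /-- `rx v` are the nodes whose first-slot transmission is received by `v` -/
  rx : V → Finset V
  /-- the nodes that detect a busy channel in the first slot (the others detect an idle one) -/
  busy : Finset V
  /-- the nodes whose `ACK` primitive has outcome 1 in the first slot -/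
  ack : Finset V
  /-- `rx' v` are the nodes whose second-slot transmission is received by `v` -/
  rx' : V → Finset V

/-- The local state of a node: it does not have the message yet; it has the message and runs
Try&Adjust with transmission probability `p`; it has the message and has stopped. -/
inductive NodeState
  | asleep
  | running (p : ℝ)
  | stopped

namespace NodeState

/-- The transmission probability in the first slot. -/
def txProb : NodeState → ℝ
  | asleep => 0
  | running p => p
  | stopped => 0

/-- The node has received the message. -/
def Informed (σ : NodeState) : Prop := σ ≠ asleep

end NodeState

/-- Initial transmission probability of Try&Adjust(β). -/
def initProb (n : ℕ) (β : ℝ) : ℝ := (1 / 2) * (n : ℝ) ^ (-β)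

open Classical in
/-- Update of the transmission probability in Try&Adjust(β). -/
def adjust (n : ℕ) (β : ℝ) (busy : Prop) (p : ℝ) : ℝ :=
  if busy then max (p / 2) ((n : ℝ) ^ (-β)) else min (2 * p) (1 / 2)

section Algorithm

variable {M : Model} {V : Type*}

open Classical in
/-- The nodes that detect `ACK` for their own first-slot transmission; exactly these transmit in
the second slot. -/
def Outcome.tx' (o : Outcome V) : Finset V := o.tx ∩ o.ack

/-- `NTD` in the second slot: `v` receives a transmission from some `u ∈ D_v^{ε/2}`. -/
def Outcome.Ntd (N : Network M V) (o : Outcome V) (v : V) : Prop :=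
  ∃ u ∈ o.rx' v, u ∈ N.vicinity v (M.ε / 2)

open Classical in
/-- One round of Bcast* (passiveness `β = 1`) at node `v`.  The node stops if it detects `ACK` for
its transmission, or if it receives a message in the first slot and detects `NTD` in the second
one.  A node that receives the message for the first time and does not stop starts
Try&Adjust(1) in the next round. -/
def step (N : Network M V) (n : ℕ) (o : Outcome V) (v : V) : NodeState → NodeState
  | .asleep =>
    if (o.rx v).Nonempty ∧ o.Ntd N v then .stopped
    else if (o.rx v).Nonempty ∨ (o.rx' v).Nonempty then .running (initProb n 1)
    else .asleep
  | .running p =>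
    if v ∈ o.tx' ∨ ((o.rx v).Nonempty ∧ o.Ntd N v) then .stopped
    else .running (adjust n 1 (v ∈ o.busy) p)
  | .stopped => .stopped

open Classical in
/-- The state of every node after a history (the most recent round is the head of the list) of
Bcast* with source `s`. -/
def state (N : Network M V) (n : ℕ) (s : V) : List (Outcome V) → V → NodeState
  | [], v => if v = s then .running (initProb n 1) else .asleep
  | o :: h, v => step N n o v (state N n s h v)

/-- First-slot transmission probabilities in the round that follows a history. -/
def txProbs (N : Network M V) (n : ℕ) (s : V) (h : List (Outcome V)) (v : V) : ℝ :=
  (state N n s h v).txProb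

end Algorithm

/-! # Adversarial executions -/

/-- Probability of the event `E`. -/
def prob {α : Type*} (μ : PMF α) (E : Set α) : ℝ := (μ.toOuterMeasure E).toReal

section Execution

variable {M : Model} {V : Type*}

/-- Reception in one slot with transmitters `S`, where `rx v` are the nodes heard by `v`: only
transmissions are received, and a transmission on a clear channel (no other transmitter in
`D_u^{ρ_c}`, interference at most `I_c`) is received by all neighbours, all at precision `δ`.
Every other reception is unconstrained. -/
def SuccClear (N : Network M V) (δ : ℝ) (S : Finset V) (rx : V → Finset V) : Prop :=
  (∀ u v, u ∈ rx v → u ∈ S ∧ u ≠ v) ∧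
  ∀ u ∈ S, (∀ w ∈ S, w ∈ N.vicinity u (M.rhoc δ) → w = u) → N.interference S u ≤ M.Ic δ →
    ∀ v ∈ N.nbhd u δ, v ≠ u → u ∈ rx v

/-- `ACK(δ)`: a transmitter `u` has outcome 1 if all of `N(u, δ)` receive its transmission and its
interference is at most `I_ack`, and outcome 0 if some node of `N(u, δ)` does not receive it. -/
def AckSpec (N : Network M V) (δ : ℝ) (S : Finset V) (rx : V → Finset V) (ack : Finset V) :
    Prop :=
  ∀ u ∈ S,
    ((∀ v ∈ N.nbhd u δ, v ≠ u → u ∈ rx v) → N.interference S u ≤ M.Iack δ → u ∈ ack) ∧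
    (u ∈ ack → ∀ v ∈ N.nbhd u δ, v ≠ u → u ∈ rx v)

open Classical in
/-- `μ` is an admissible distribution of the outcome of a round in which the nodes use the
first-slot transmission probabilities `p`. -/
structure AdmissibleRound [Fintype V] (N : Network M V) (ρ : ℝ) (p : V → ℝ)
    (μ : PMF (Outcome V)) : Prop where
  /-- each node `v` transmits with probability `p v`, independently of the others -/
  tx_law : ∀ A : Finset V, prob μ {o | o.tx = A} = ∏ v, if v ∈ A then p v else 1 - p v
  slot1 : ∀ o ∈ μ.support, SuccClear N (M.ε / 2) o.tx o.rx
  ack : ∀ o ∈ μ.support, AckSpec N (M.ε / 2) o.tx o.rx o.ack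
  slot2 : ∀ o ∈ μ.support, SuccClear N (M.ε / 2) o.tx' o.rx'
  /-- `CD`, high contention: all close neighbours detect a busy channel with probability at least
  `1 - h₁^{-φ}` -/
  cd_busy : ∀ (v : V) (φ : ℝ), M.phi0 < φ → φ < N.closeContention p v →
    1 - M.h1 ^ (-φ) ≤ prob μ {o | ∀ w ∈ ball N.d v (M.R / 2), w ∈ o.busy}
  /-- `CD`, low contention: given that the interference from outside of the vicinity is below
  `I_cd`, an idle channel is detected with probability at least `h₂^{-η}` -/
  cd_idle : ∀ (v : V) (η : ℝ), 0 < η → N.vicinityContention ρ p v ≤ η →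
    M.h2 ^ (-η) * prob μ {o | N.farInterference ρ o.tx v < M.Icd} ≤
      prob μ {o | v ∉ o.busy ∧ N.farInterference ρ o.tx v < M.Icd}

/-- The distribution of the history of the first `t` rounds, if `env h` is the distribution of the
outcome of the next round given the history `h`. -/
def law (env : List (Outcome V) → PMF (Outcome V)) : ℕ → PMF (List (Outcome V))
  | 0 => PMF.pure []
  | t + 1 => (law env t).bind fun h => (env h).map fun o => o :: h

/-- `env` (an adaptive adversary together with the coin flips of the nodes) describes an execution
of Bcast* with source `s` and estimate `n` for the number of nodes; the vicinities in `CD` have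
relative radius `ρ`. -/
def IsExecution [Fintype V] (N : Network M V) (ρ : ℝ) (n : ℕ) (s : V)
    (env : List (Outcome V) → PMF (Outcome V)) : Prop :=
  ∀ t, ∀ h ∈ (law env t).support, AdmissibleRound N ρ (txProbs N n s h) (env h)

end Execution

end

end Wireless

/-! It suffices to control one edge `v → w` of the communication graph: an informed `v` has `w`
informed after `O(log n)` rounds, up to a polynomially small error (`exists_progress`). The errors
add up along a shortest path.

While `w` is uninformed, `v` cannot have stopped: ACK, or NTD from a nearby acknowledged node,
certifies that all of `N(v, ε)` has been reached (`informed_of_stopped`). So `v` keeps running, and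
a potential shows that this does not last. The potential is a small negative power of the
transmission probability of `v`, times `2^m`, where `m` is the largest number of separated nodes of
`D_v^ρ` that have not stopped. It is at least `1` while `v` runs, and polynomial in `n` because
bounded independence bounds `m`. If the contention around `v` is low, `v` probably detects Idle and
doubles its probability. Otherwise, with constant probability, exactly one node of the vicinity
transmits, and clearly; the nodes near it stop and `m` drops (`activePacking_cons_lt`). Either way
the potential loses a constant factor in expectation (`expect_potential_le`), provided that
contention and far interference are bounded in that round.

Outside a rare event, nine tenths of the rounds satisfy this proviso. The busy guarantee pulls a
large contention down, so its exponential moments stay bounded, and its average over a window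
exceeds a constant only with probability exponentially small in the length of the window
(`prob_windowSum_contention_le`). Boundedly many close neighbourhoods cover a vicinity, and far
interference is a geometric series over dyadic annuli, as `growth < ζ`. These bounds are linear in
the weights, hence apply to probabilities summed over the window (`windowSum_unrest_le`). -/

namespace Wireless
open scoped ENNReal

/-! # Expectations of nonnegative functions under a `PMF` -/

section Expectation

variable {α β : Type*}

/-- Expectation of an extended nonnegative function. -/
noncomputable def expect (μ : PMF α) (g : α → ℝ≥0∞) : ℝ≥0∞ := ∑' a, μ a * g a

theorem expect_mono {μ : PMF α} {g g' : α → ℝ≥0∞} (h : ∀ a ∈ μ.support, g a ≤ g' a) :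
    expect μ g ≤ expect μ g' := by
  refine ENNReal.tsum_le_tsum fun a => ?_
  by_cases ha : μ a = 0
  · simp [ha]
  · gcongr
    exact h a ((PMF.mem_support_iff _ _).2 ha)

theorem expect_const (μ : PMF α) (c : ℝ≥0∞) : expect μ (fun _ => c) = c := by
  simp [expect, ENNReal.tsum_mul_right, μ.tsum_coe]

theorem expect_le_of_le {μ : PMF α} {g : α → ℝ≥0∞} {c : ℝ≥0∞} (h : ∀ a ∈ μ.support, g a ≤ c) :
    expect μ g ≤ c :=
  (expect_mono h).trans_eq (expect_const μ c)

theorem expect_pure (a : α) (g : α → ℝ≥0∞) : expect (PMF.pure a) g = g a := by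
  classical
  rw [expect, tsum_eq_single a]
  · simp
  · intro b hb
    simp [PMF.pure_apply, hb]

theorem expect_bind (μ : PMF α) (f : α → PMF β) (g : β → ℝ≥0∞) :
    expect (μ.bind f) g = expect μ fun a => expect (f a) g := by
  simp only [expect, PMF.bind_apply, ← ENNReal.tsum_mul_right, ← ENNReal.tsum_mul_left]
  rw [ENNReal.tsum_comm]
  simp only [mul_assoc]

theorem expect_map (μ : PMF α) (f : α → β) (g : β → ℝ≥0∞) :
    expect (μ.map f) g = expect μ fun a => g (f a) := by
  rw [PMF.map, expect_bind]
  simp only [Function.comp, expect_pure]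

theorem expect_add (μ : PMF α) (g g' : α → ℝ≥0∞) :
    expect μ (fun a => g a + g' a) = expect μ g + expect μ g' := by
  simp [expect, mul_add, ENNReal.tsum_add]

theorem expect_const_mul (μ : PMF α) (c : ℝ≥0∞) (g : α → ℝ≥0∞) :
    expect μ (fun a => c * g a) = c * expect μ g := by
  simp only [expect, ← ENNReal.tsum_mul_left]
  exact tsum_congr fun a => by ring

theorem toOuterMeasure_eq_expect (μ : PMF α) (E : Set α) :
    μ.toOuterMeasure E = expect μ (E.indicator 1) := by
  rw [PMF.toOuterMeasure_apply, expect]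
  refine tsum_congr fun a => ?_
  by_cases h : a ∈ E <;> simp [h]

theorem toOuterMeasure_le_one (μ : PMF α) (E : Set α) : μ.toOuterMeasure E ≤ 1 := by
  rw [toOuterMeasure_eq_expect]
  refine expect_le_of_le fun a _ => ?_
  by_cases h : a ∈ E <;> simp [h]

theorem ofReal_prob (μ : PMF α) (E : Set α) :
    ENNReal.ofReal (prob μ E) = expect μ (E.indicator 1) := by
  rw [prob, ENNReal.ofReal_toReal ((toOuterMeasure_le_one μ E).trans_lt ENNReal.one_lt_top).ne,
    toOuterMeasure_eq_expect]

theorem prob_nonneg (μ : PMF α) (E : Set α) : 0 ≤ prob μ E := ENNReal.toReal_nonneg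

theorem prob_le_of_expect_le {μ : PMF α} {E : Set α} {b : ℝ} (hb : 0 ≤ b)
    (h : expect μ (E.indicator 1) ≤ ENNReal.ofReal b) : prob μ E ≤ b := by
  rw [← ofReal_prob] at h
  exact (ENNReal.ofReal_le_ofReal_iff hb).1 h

theorem prob_mono {μ : PMF α} {E F : Set α} (h : ∀ a ∈ μ.support, a ∈ E → a ∈ F) :
    prob μ E ≤ prob μ F := by
  refine prob_le_of_expect_le (prob_nonneg _ _) ?_
  rw [ofReal_prob]
  refine expect_mono fun a ha => ?_
  by_cases hE : a ∈ E
  · simp [hE, h a ha hE]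
  · simp [hE]

theorem prob_eq_zero {μ : PMF α} {E : Set α} (h : ∀ a ∈ μ.support, a ∉ E) : prob μ E = 0 := by
  refine le_antisymm (prob_le_of_expect_le le_rfl (expect_le_of_le fun a ha => ?_)) (prob_nonneg _ _)
  simp [h a ha]

theorem prob_union_le (μ : PMF α) (E F : Set α) : prob μ (E ∪ F) ≤ prob μ E + prob μ F := by
  refine prob_le_of_expect_le (add_nonneg (prob_nonneg _ _) (prob_nonneg _ _)) ?_
  rw [ENNReal.ofReal_add (prob_nonneg _ _) (prob_nonneg _ _), ofReal_prob, ofReal_prob,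
    ← expect_add]
  refine expect_mono fun a _ => ?_
  by_cases hE : a ∈ E <;> by_cases hF : a ∈ F <;> simp [hE, hF]

theorem prob_add_prob_compl (μ : PMF α) (E : Set α) : prob μ E + prob μ Eᶜ = 1 := by
  rw [← ENNReal.ofReal_eq_ofReal_iff (add_nonneg (prob_nonneg _ _) (prob_nonneg _ _)) zero_le_one,
    ENNReal.ofReal_add (prob_nonneg _ _) (prob_nonneg _ _), ofReal_prob, ofReal_prob, ← expect_add,
    ENNReal.ofReal_one, ← expect_const μ 1]
  congr 1
  funext a
  by_cases hE : a ∈ E <;> simp [hE]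

theorem prob_exists_le {ι : Type*} (μ : PMF α) (s : Finset ι) (E : ι → Set α) :
    prob μ {a | ∃ i ∈ s, a ∈ E i} ≤ ∑ i ∈ s, prob μ (E i) := by
  classical
  induction s using Finset.induction_on with
  | empty => simp [prob_eq_zero]
  | insert i s hi ih =>
    rw [Finset.sum_insert hi]
    refine le_trans (prob_mono ?_) ((prob_union_le μ (E i) {a | ∃ i ∈ s, a ∈ E i}).trans
      (by gcongr))
    rintro a - ⟨j, hj, ha⟩
    rcases Finset.mem_insert.1 hj with rfl | hj
    · exact Or.inl ha
    · exact Or.inr ⟨j, hj, ha⟩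

/-- Markov's inequality. -/
theorem prob_le_div {μ : PMF α} {E : Set α} {g : α → ℝ≥0∞} {A B : ℝ} (hA : 0 < A) (hB : 0 ≤ B)
    (hg : ∀ a ∈ μ.support, a ∈ E → ENNReal.ofReal A ≤ g a)
    (h : expect μ g ≤ ENNReal.ofReal B) : prob μ E ≤ B / A := by
  rw [le_div_iff₀ hA, mul_comm]
  rw [← ENNReal.ofReal_le_ofReal_iff hB, ENNReal.ofReal_mul hA.le, ofReal_prob, ← expect_const_mul]
  refine (expect_mono fun a ha => ?_).trans h
  by_cases hE : a ∈ E
  · simpa [hE] using hg a ha hE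
  · simp [hE]

/-- The expectation of a function that is at most `A` on an event of probability at least `q` and at
most `B` everywhere. -/
theorem expect_le_of_prob_le {μ : PMF α} {E : Set α} {g : α → ℝ} {q A B : ℝ} (hA : 0 ≤ A)
    (hAB : A ≤ B) (hq : q ≤ prob μ E) (hgA : ∀ a ∈ μ.support, a ∈ E → g a ≤ A)
    (hgB : ∀ a ∈ μ.support, g a ≤ B) :
    expect μ (fun a => ENNReal.ofReal (g a)) ≤ ENNReal.ofReal (q * A + (1 - q) * B) := by
  have h1 : expect μ (fun a => ENNReal.ofReal (g a)) ≤
      expect μ (fun a => ENNReal.ofReal A * E.indicator 1 a +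
        ENNReal.ofReal B * Eᶜ.indicator 1 a) := by
    refine expect_mono fun a ha => ?_
    by_cases hE : a ∈ E
    · simpa [hE] using ENNReal.ofReal_le_ofReal (hgA a ha hE)
    · simpa [hE] using ENNReal.ofReal_le_ofReal (hgB a ha)
  refine h1.trans ?_
  rw [expect_add, expect_const_mul, expect_const_mul, ← ofReal_prob, ← ofReal_prob,
    ← ENNReal.ofReal_mul hA, ← ENNReal.ofReal_mul (hA.trans hAB),
    ← ENNReal.ofReal_add (mul_nonneg hA (prob_nonneg _ _))
      (mul_nonneg (hA.trans hAB) (prob_nonneg _ _))]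
  refine ENNReal.ofReal_le_ofReal ?_
  have h2 := prob_add_prob_compl μ E
  rw [show prob μ Eᶜ = 1 - prob μ E by linarith]
  nlinarith [mul_le_mul_of_nonneg_right hq (sub_nonneg.2 hAB)]

end Expectation

/-! # Potential functions along an execution -/

section Law

variable {V : Type*} (env : List (Outcome V) → PMF (Outcome V))

theorem expect_law_succ (t : ℕ) (g : List (Outcome V) → ℝ≥0∞) :
    expect (law env (t + 1)) g =
      expect (law env t) fun h => expect (env h) fun o => g (o :: h) := by
  rw [law, expect_bind]
  simp only [expect_map]

theorem mem_support_law_succ {t : ℕ} {h : List (Outcome V)} :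
    h ∈ (law env (t + 1)).support ↔
      ∃ h' ∈ (law env t).support, ∃ o ∈ (env h').support, h = o :: h' := by
  simp [law, eq_comm]

/-- A potential that does not increase in expectation in any round does not increase. -/
theorem expect_law_add_le (T : ℕ) (Φ : ℕ → List (Outcome V) → ℝ≥0∞)
    (hΦ : ∀ τ, ∀ h ∈ (law env (T + τ)).support,
      expect (env h) (fun o => Φ (τ + 1) (o :: h)) ≤ Φ τ h) (τ : ℕ) :
    expect (law env (T + τ)) (Φ τ) ≤ expect (law env T) (Φ 0) := by
  induction τ with
  | zero => exact le_rfl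
  | succ τ ih =>
    rw [← add_assoc, expect_law_succ]
    exact (expect_mono (hΦ τ)).trans ih

/-- The head of a history is its latest round, so `drop τ` goes back `τ` rounds; the indicator of
`E` at that time is a potential that later rounds leave unchanged. -/
theorem prob_law_drop_le (T τ : ℕ) (E : Set (List (Outcome V))) :
    prob (law env (T + τ)) {h | h.drop τ ∈ E} ≤ prob (law env T) E := by
  refine prob_le_of_expect_le (prob_nonneg _ _) ?_
  rw [ofReal_prob]
  refine expect_law_add_le env T (fun τ h => Set.indicator {h | h.drop τ ∈ E} 1 h) ?_ τ
  intro τ h _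
  refine expect_le_of_le fun o _ => ?_
  by_cases hE : h.drop τ ∈ E <;> simp [hE]

/-- Sum of `X` over the histories before each of the last `τ` rounds. -/
def windowSum (X : List (Outcome V) → ℝ) (τ : ℕ) (h : List (Outcome V)) : ℝ :=
  ∑ i ∈ Finset.range τ, X (h.drop (i + 1))

@[simp] theorem windowSum_zero (X : List (Outcome V) → ℝ) (h : List (Outcome V)) :
    windowSum X 0 h = 0 := by
  simp [windowSum]

theorem windowSum_succ_cons (X : List (Outcome V) → ℝ) (τ : ℕ) (o : Outcome V)
    (h : List (Outcome V)) : windowSum X (τ + 1) (o :: h) = X h + windowSum X τ h := by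
  simp [windowSum, Finset.sum_range_succ', add_comm]

theorem windowSum_mono {X Y : List (Outcome V) → ℝ} (hXY : ∀ h, X h ≤ Y h) (τ : ℕ)
    (h : List (Outcome V)) : windowSum X τ h ≤ windowSum Y τ h :=
  Finset.sum_le_sum fun _ _ => hXY _

end Law

/-! # Geometry of the network -/

section Geometry

variable {M : Model} {V : Type*} (N : Network M V)

theorem Model.one_lt_ζ (M : Model) : 1 < M.ζ := M.one_le_growth.trans_lt M.growth_lt_ζ

theorem Network.d_self (u : V) : N.d u u = 0 := by simp [Network.d, qdist]

theorem Network.d_of_ne {u v : V} (h : u ≠ v) : N.d u v = N.f u v ^ (1 / M.ζ) := by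
  simp [Network.d, qdist, h]

theorem Network.d_nonneg (u v : V) : 0 ≤ N.d u v := by
  by_cases h : u = v
  · simp [h, N.d_self]
  · rw [N.d_of_ne h]
    exact Real.rpow_nonneg (N.f_pos u v).le _

theorem Network.d_triangle (u w v : V) : N.d u v ≤ N.d u w + N.d w v := by
  by_cases huv : u = v
  · subst huv
    rw [N.d_self]
    exact add_nonneg (N.d_nonneg _ _) (N.d_nonneg _ _)
  by_cases huw : u = w
  · subst huw
    simp [N.d_self]
  by_cases hwv : w = v
  · subst hwv
    simp [N.d_self]
  rw [N.d_of_ne huv, N.d_of_ne huw, N.d_of_ne hwv]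
  exact N.metricity u v w

theorem Network.signal_eq {u v : V} (h : u ≠ v) : N.signal u v = M.P * N.d u v ^ (-M.ζ) := by
  rw [Network.signal, N.d_of_ne h, ← Real.rpow_mul (N.f_pos u v).le,
    show 1 / M.ζ * -M.ζ = -1 by have := M.one_lt_ζ; field_simp, Real.rpow_neg_one, div_eq_mul_inv]

theorem Network.signal_nonneg (u v : V) : 0 ≤ N.signal u v :=
  div_nonneg M.P_pos.le (N.f_pos u v).le

theorem Network.signal_le {u v : V} {r : ℝ} (hr : 0 < r) (h : r ≤ N.d u v) :
    N.signal u v ≤ M.P * r ^ (-M.ζ) := by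
  have hne : u ≠ v := by
    rintro rfl
    rw [N.d_self] at h
    linarith
  rw [N.signal_eq hne]
  exact mul_le_mul_of_nonneg_left
    (Real.rpow_le_rpow_of_nonpos hr h (by linarith [M.one_lt_ζ])) M.P_pos.le

theorem Network.mem_vicinity_self {ρ : ℝ} (hρ : 0 < ρ) (v : V) : v ∈ N.vicinity v ρ := by
  simp only [Network.vicinity, inBall, Set.mem_ofPred_eq]
  rw [N.d_self]
  exact mul_pos hρ M.R_pos

/-- The points of `S` have pairwise disjoint balls of radius `rmin`. -/
def Network.IsSeparated (S : Finset V) : Prop :=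
  ∀ u ∈ S, ∀ v ∈ S, u ≠ v → Disjoint (ball N.d u M.rmin) (ball N.d v M.rmin)

/-- Upper bound on the number of separated points in an in-ball of radius `r`. -/
noncomputable def Model.packBound (M : Model) (r : ℝ) : ℝ :=
  |M.C| * (r / M.rmin + 1) ^ M.growth

theorem Model.packBound_nonneg (M : Model) {r : ℝ} (hr : 0 ≤ r) : 0 ≤ M.packBound r :=
  mul_nonneg (abs_nonneg _)
    (Real.rpow_nonneg (add_nonneg (div_nonneg hr M.rmin_nonneg) zero_le_one) _)

/-- The balls around `S` fit into the in-ball of radius `r + rmin`. For `rmin = 0` all balls are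
empty, every set is separated, and `r / 0 = 0` turns `packBound r` into `|C|`. -/
theorem Network.IsSeparated.card_le {N : Network M V} {S : Finset V} (hS : N.IsSeparated S) {v : V}
    {r : ℝ} (hr : 0 ≤ r) (hSv : ∀ u ∈ S, u ∈ inBall N.d v r) : (S.card : ℝ) ≤ M.packBound r := by
  have hq : (1 : ℝ) ≤ r / M.rmin + 1 := by
    have := div_nonneg hr M.rmin_nonneg
    linarith
  refine (N.independence _ hq v S ⟨fun u hu y hy => ?_, hS⟩).trans
    (mul_le_mul_of_nonneg_right (le_abs_self _) (Real.rpow_nonneg (by linarith) _))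
  have hy : max (N.d y u) (N.d u y) < M.rmin := hy
  have huv : N.d u v < r := hSv u hu
  have h1 : 0 < M.rmin := ((N.d_nonneg y u).trans (le_max_left _ _)).trans_lt hy
  have h2 := (le_max_left _ _).trans_lt hy
  have h3 : (r / M.rmin + 1) * M.rmin = r + M.rmin := by field_simp
  change N.d y v < _
  rw [h3]
  linarith [N.d_triangle y u v]

theorem Model.two_rmin_lt (M : Model) : 2 * M.rmin < M.R / 2 := by
  have := mul_lt_mul_of_pos_right M.ε_lt_one M.R_pos
  linarith [M.rmin_le]

/-- An in-ball of radius `r` is covered by few close neighbourhoods. -/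
theorem Network.exists_cover [Fintype V] (v : V) {r : ℝ} (hr : 0 ≤ r) :
    ∃ S : Finset V, (S.card : ℝ) ≤ M.packBound r ∧
      ∀ y ∈ inBall N.d v r, ∃ x ∈ S, y ∈ ball N.d x (M.R / 2) := by
  classical
  -- A separated set of maximal cardinality works: a point missed by all the close neighbourhoods
  -- could be added to it, because `2 * rmin < R / 2`.
  obtain ⟨S, hS, hmax⟩ := Finset.exists_max_image
    (Finset.univ.filter fun S : Finset V => N.IsSeparated S ∧ ∀ u ∈ S, u ∈ inBall N.d v r)
    Finset.card ⟨∅, Finset.mem_filter.2 ⟨Finset.mem_univ _, by simp [Network.IsSeparated]⟩⟩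
  simp only [Finset.mem_filter, Finset.mem_univ, true_and] at hS hmax
  refine ⟨S, hS.1.card_le hr hS.2, fun y hy => ?_⟩
  by_contra! hcon
  have hyS : y ∉ S := fun h => hcon y h (by
    simp only [ball, Set.mem_ofPred_eq, N.d_self, max_self]
    linarith [M.R_pos])
  have hdisj : ∀ x ∈ S, Disjoint (ball N.d x M.rmin) (ball N.d y M.rmin) := by
    intro x hx
    rw [Set.disjoint_left]
    intro z hzx hzy
    simp only [ball, Set.mem_ofPred_eq, max_lt_iff] at hzx hzy
    refine hcon x hx ?_
    simp only [ball, Set.mem_ofPred_eq, max_lt_iff]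
    have := M.two_rmin_lt
    constructor
    · linarith [N.d_triangle y z x]
    · linarith [N.d_triangle x z y]
  have := hmax (insert y S) ⟨?_, ?_⟩
  · rw [Finset.card_insert_of_notMem hyS] at this
    omega
  · intro u hu w hw huw
    rcases Finset.mem_insert.1 hu with hu | hu <;> rcases Finset.mem_insert.1 hw with hw | hw
    · exact absurd (hu.trans hw.symm) huw
    · exact hu ▸ (hdisj w hw).symm
    · exact hw ▸ hdisj u hu
    · exact hS.1 u hu w hw huw
  · intro u hu
    rcases Finset.mem_insert.1 hu with rfl | hu
    · exact hy
    · exact hS.2 u hu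

variable [Fintype V]

/-- Summation over a cover. The weights are arbitrary, so that they can later be transmission
probabilities summed over many rounds. -/
theorem Network.vicinityContention_le {q : V → ℝ} (hq : ∀ w, 0 ≤ q w) {b : ℝ}
    (hb : ∀ x, N.closeContention q x ≤ b) {ρ : ℝ} (hρ : 0 ≤ ρ) (v : V) :
    N.vicinityContention ρ q v ≤ M.packBound (ρ * M.R) * b := by
  classical
  obtain ⟨S, hcard, hcov⟩ := N.exists_cover v (mul_nonneg hρ M.R_pos.le)
  have hb0 : 0 ≤ b := (Finset.sum_nonneg fun w _ => hq w).trans (hb v)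
  have hpos : ∀ w, ∀ x, 0 ≤ if w ∈ ball N.d x (M.R / 2) then q w else 0 := fun w x => by
    split_ifs
    exacts [hq w, le_rfl]
  calc N.vicinityContention ρ q v
      ≤ ∑ w with w ∈ N.vicinity v ρ, ∑ x ∈ S, if w ∈ ball N.d x (M.R / 2) then q w else 0 := by
        refine Finset.sum_le_sum fun w hw => ?_
        obtain ⟨x, hx, hwx⟩ := hcov w (Finset.mem_filter.1 hw).2
        refine le_trans ?_ (Finset.single_le_sum (fun y _ => hpos w y) hx)
        rw [if_pos hwx]
    _ ≤ ∑ w, ∑ x ∈ S, if w ∈ ball N.d x (M.R / 2) then q w else 0 :=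
        Finset.sum_le_sum_of_subset_of_nonneg (Finset.filter_subset _ _) fun w _ _ =>
          Finset.sum_nonneg fun x _ => hpos w x
    _ = ∑ x ∈ S, N.closeContention q x := by
        rw [Finset.sum_comm]
        refine Finset.sum_congr rfl fun x _ => ?_
        rw [Network.closeContention, Finset.sum_filter]
    _ ≤ S.card * b := by
        rw [← nsmul_eq_mul]
        exact Finset.sum_le_card_nsmul _ _ _ fun x _ => hb x
    _ ≤ _ := mul_le_mul_of_nonneg_right hcard hb0

open Classical in
/-- The expected interference at `v` from outside of the vicinity `D_v^ρ`. -/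
noncomputable def Network.farWeight (ρ : ℝ) (q : V → ℝ) (v : V) : ℝ :=
  ∑ w with w ∉ N.vicinity v ρ, q w * N.signal w v

/-- Constant in the bound on the far interference. -/
noncomputable def Model.farConst (M : Model) : ℝ :=
  M.P * |M.C| * (1 / M.rmin + 1 / M.R) ^ M.growth * 2 ^ M.growth / (1 - 2 ^ (M.growth - M.ζ))

theorem Model.two_rpow_lt_one (M : Model) : (2 : ℝ) ^ (M.growth - M.ζ) < 1 :=
  Real.rpow_lt_one_of_one_lt_of_neg (by norm_num) (by linarith [M.growth_lt_ζ])

theorem Model.packBound_le (M : Model) {r : ℝ} (hr : M.R ≤ r) :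
    M.packBound r ≤ |M.C| * (1 / M.rmin + 1 / M.R) ^ M.growth * r ^ M.growth := by
  have hR := M.R_pos
  have hm := M.rmin_nonneg
  have hr0 : 0 < r := hR.trans_le hr
  rw [Model.packBound, mul_assoc, ← Real.mul_rpow (by positivity) hr0.le]
  refine mul_le_mul_of_nonneg_left (Real.rpow_le_rpow (by positivity) ?_
    (by linarith [M.one_le_growth])) (abs_nonneg _)
  have h1 : 1 ≤ r / M.R := (one_le_div hR).2 hr
  have h2 : (1 / M.rmin + 1 / M.R) * r = r / M.rmin + r / M.R := by ring
  linarith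

/-- Dyadic annuli: at distance about `2^j ρR` a signal is of order `(2^j ρR)^(-ζ)`, and the total
weight is of order `(2^j ρR)^growth * b`. The resulting series is geometric with ratio `2^(growth -
ζ) < 1`. -/
theorem Network.farWeight_le {q : V → ℝ} (hq : ∀ w, 0 ≤ q w) {b : ℝ}
    (hb : ∀ x, N.closeContention q x ≤ b) {ρ : ℝ} (hρ : 1 ≤ ρ) (v : V) :
    N.farWeight ρ q v ≤ M.farConst * (ρ * M.R) ^ (M.growth - M.ζ) * b := by
  classical
  have hb0 : 0 ≤ b := (Finset.sum_nonneg fun w _ => hq w).trans (hb v)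
  have hR := M.R_pos
  have hP := M.P_pos
  set s := ρ * M.R with hs
  have hs0 : 0 < s := by positivity
  have hRs : M.R ≤ s := le_mul_of_one_le_left hR.le hρ
  obtain ⟨J, hJ⟩ : ∃ J : ℕ, ∀ w, N.d w v < 2 ^ J * s := by
    obtain ⟨D, hD⟩ := (Finset.univ.image fun w => N.d w v / s).bddAbove
    obtain ⟨J, hJ⟩ := pow_unbounded_of_one_lt D (one_lt_two (α := ℝ))
    refine ⟨J, fun w => ?_⟩
    rw [← div_lt_iff₀ hs0]
    exact (hD (by simp)).trans_lt hJ
  have hpt : ∀ w, w ∉ N.vicinity v ρ → q w * N.signal w v ≤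
      ∑ j ∈ Finset.range J, M.P * (2 ^ j * s) ^ (-M.ζ) *
        (if w ∈ N.vicinity v (2 ^ (j + 1) * ρ) then q w else 0) := by
    intro w hw
    have hw' : s ≤ N.d w v := not_lt.1 hw
    -- `Nat.find` selects the annulus of `w`; index `0` is impossible for a node outside the
    -- vicinity.
    have hex : ∃ j : ℕ, N.d w v < 2 ^ j * s := ⟨J, hJ w⟩
    obtain ⟨j, hj⟩ : ∃ j, Nat.find hex = j + 1 := by
      refine Nat.exists_eq_succ_of_ne_zero fun h0 => ?_
      have := Nat.find_spec hex
      rw [h0] at this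
      simp only [pow_zero, one_mul] at this
      linarith
    have h1 : N.d w v < 2 ^ (j + 1) * s := hj ▸ Nat.find_spec hex
    have h2 : 2 ^ j * s ≤ N.d w v := not_lt.1 (Nat.find_min hex (by omega : j < Nat.find hex))
    have hjJ : j < J := by
      have := Nat.find_min' hex (hJ w)
      omega
    refine le_trans ?_ (Finset.single_le_sum (fun i _ => ?_) (Finset.mem_range.2 hjJ))
    · have hmem : w ∈ N.vicinity v (2 ^ (j + 1) * ρ) := by
        change N.d w v < 2 ^ (j + 1) * ρ * M.R
        rwa [mul_assoc]
      rw [if_pos hmem, mul_comm]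
      exact mul_le_mul_of_nonneg_right (N.signal_le (by positivity) h2) (hq w)
    · have : 0 ≤ (if w ∈ N.vicinity v (2 ^ (i + 1) * ρ) then q w else 0) := by
        split_ifs
        exacts [hq w, le_rfl]
      positivity
  have hrat := M.two_rpow_lt_one
  have hrat0 : (0 : ℝ) ≤ 2 ^ (M.growth - M.ζ) := by positivity
  have hterm : ∀ j : ℕ, M.P * (2 ^ j * s) ^ (-M.ζ) * M.packBound (2 ^ (j + 1) * ρ * M.R) ≤
      M.P * |M.C| * (1 / M.rmin + 1 / M.R) ^ M.growth * 2 ^ M.growth *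
        s ^ (M.growth - M.ζ) * (2 ^ (M.growth - M.ζ)) ^ j := by
    intro j
    have h2j : (1 : ℝ) ≤ 2 ^ (j + 1) := one_le_pow₀ (by norm_num)
    have hpb := M.packBound_le (r := 2 ^ (j + 1) * ρ * M.R) (by
      rw [mul_assoc]
      exact hRs.trans (le_mul_of_one_le_left hs0.le h2j))
    refine (mul_le_mul_of_nonneg_left hpb (by positivity)).trans_eq ?_
    have e1 : (2 : ℝ) ^ (j + 1) * ρ * M.R = 2 * (2 ^ j * s) := by rw [hs]; ring
    have e2 : ((2 : ℝ) ^ (M.growth - M.ζ)) ^ j = (2 ^ j) ^ (M.growth - M.ζ) := by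
      rw [← Real.rpow_natCast, ← Real.rpow_natCast, ← Real.rpow_mul (by norm_num),
        ← Real.rpow_mul (by norm_num), mul_comm]
    rw [e1, e2, mul_assoc (M.P * |M.C| * (1 / M.rmin + 1 / M.R) ^ M.growth * 2 ^ M.growth),
      ← Real.mul_rpow hs0.le (by positivity), mul_comm s]
    have hy : 0 < 2 ^ j * s := by positivity
    generalize 2 ^ j * s = y at hy
    rw [Real.mul_rpow (by norm_num) hy.le, sub_eq_add_neg M.growth, Real.rpow_add hy]
    ring
  calc N.farWeight ρ q v
      ≤ ∑ w with w ∉ N.vicinity v ρ, ∑ j ∈ Finset.range J, M.P * (2 ^ j * s) ^ (-M.ζ) *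
        (if w ∈ N.vicinity v (2 ^ (j + 1) * ρ) then q w else 0) :=
        Finset.sum_le_sum fun w hw => hpt w (by simpa using hw)
    _ ≤ ∑ w, ∑ j ∈ Finset.range J, M.P * (2 ^ j * s) ^ (-M.ζ) *
        (if w ∈ N.vicinity v (2 ^ (j + 1) * ρ) then q w else 0) := by
        refine Finset.sum_le_sum_of_subset_of_nonneg (Finset.filter_subset _ _) fun w _ _ =>
          Finset.sum_nonneg fun i _ => ?_
        have : 0 ≤ (if w ∈ N.vicinity v (2 ^ (i + 1) * ρ) then q w else 0) := by
          split_ifs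
          exacts [hq w, le_rfl]
        positivity
    _ = ∑ j ∈ Finset.range J, M.P * (2 ^ j * s) ^ (-M.ζ) *
          N.vicinityContention (2 ^ (j + 1) * ρ) q v := by
        rw [Finset.sum_comm]
        refine Finset.sum_congr rfl fun j _ => ?_
        rw [← Finset.mul_sum, Network.vicinityContention, Finset.sum_filter]
    _ ≤ ∑ j ∈ Finset.range J, M.P * (2 ^ j * s) ^ (-M.ζ) *
          (M.packBound (2 ^ (j + 1) * ρ * M.R) * b) := by
        refine Finset.sum_le_sum fun j _ => mul_le_mul_of_nonneg_left ?_ (by positivity)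
        exact N.vicinityContention_le hq hb (by positivity) v
    _ ≤ ∑ j ∈ Finset.range J, M.P * |M.C| * (1 / M.rmin + 1 / M.R) ^ M.growth * 2 ^ M.growth *
        s ^ (M.growth - M.ζ) * (2 ^ (M.growth - M.ζ)) ^ j * b := by
        refine Finset.sum_le_sum fun j _ => ?_
        rw [← mul_assoc]
        exact mul_le_mul_of_nonneg_right (hterm j) hb0
    _ = M.P * |M.C| * (1 / M.rmin + 1 / M.R) ^ M.growth * 2 ^ M.growth *
        s ^ (M.growth - M.ζ) * (∑ j ∈ Finset.range J, (2 ^ (M.growth - M.ζ)) ^ j) * b := by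
        rw [← Finset.sum_mul, ← Finset.mul_sum]
    _ ≤ M.P * |M.C| * (1 / M.rmin + 1 / M.R) ^ M.growth * 2 ^ M.growth *
        s ^ (M.growth - M.ζ) * (1 / (1 - 2 ^ (M.growth - M.ζ))) * b := by
        have hm := M.rmin_nonneg
        refine mul_le_mul_of_nonneg_right (mul_le_mul_of_nonneg_left ?_ (by positivity)) hb0
        rw [one_div, ← tsum_geometric_of_lt_one hrat0 hrat]
        exact (summable_geometric_of_lt_one hrat0 hrat).sum_le_tsum _ fun j _ => by positivity
    _ = _ := by
        rw [Model.farConst]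
        ring

end Geometry

/-! # Evolution of the local states -/

section States

variable {M : Model} {V : Type*} (N : Network M V) {n : ℕ} (s : V)

theorem initProb_one (n : ℕ) : initProb n 1 = 1 / 2 * (n : ℝ)⁻¹ := by
  rw [initProb, Real.rpow_neg_one]

theorem inv_natCast_le_half (hn : 2 ≤ n) : (n : ℝ)⁻¹ ≤ 1 / 2 := by
  rw [one_div]
  exact inv_anti₀ (by norm_num) (by exact_mod_cast hn)

theorem adjust_busy (n : ℕ) {b : Prop} (hb : b) (p : ℝ) : adjust n 1 b p = max (p / 2) (n : ℝ)⁻¹ := by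
  rw [adjust, if_pos hb, Real.rpow_neg_one]

theorem adjust_idle (n : ℕ) {b : Prop} (hb : ¬b) (p : ℝ) : adjust n 1 b p = min (2 * p) (1 / 2) := by
  rw [adjust, if_neg hb]

theorem state_running_bounds (hn : 2 ≤ n) : ∀ (h : List (Outcome V)) (v : V) (p : ℝ),
    state N n s h v = .running p → 1 / 2 * (n : ℝ)⁻¹ ≤ p ∧ p ≤ 1 / 2 := by
  have hn' := inv_natCast_le_half hn
  have hn0 : 0 ≤ (n : ℝ)⁻¹ := by positivity
  intro h
  induction h with
  | nil =>
    intro v p hp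
    rw [state] at hp
    split_ifs at hp
    cases hp
    rw [initProb_one]
    constructor <;> linarith
  | cons o h ih =>
    intro v p hp
    rw [state] at hp
    cases hst : state N n s h v with
    | asleep =>
      rw [hst, step] at hp
      split_ifs at hp
      cases hp
      rw [initProb_one]
      constructor <;> linarith
    | running q =>
      rw [hst, step] at hp
      split_ifs at hp
      cases hp
      obtain ⟨h1, h2⟩ := ih v q hst
      by_cases hb : v ∈ o.busy
      · rw [adjust_busy n hb]
        exact ⟨le_trans (by linarith) (le_max_right _ _), max_le (by linarith) hn'⟩
      · rw [adjust_idle n hb]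
        exact ⟨le_min (by linarith) (by linarith), min_le_right _ _⟩
    | stopped =>
      rw [hst, step] at hp
      cases hp

theorem txProbs_nonneg (hn : 2 ≤ n) (h : List (Outcome V)) (v : V) : 0 ≤ txProbs N n s h v := by
  rw [txProbs]
  cases hst : state N n s h v with
  | running p => exact le_trans (by positivity) (state_running_bounds N s hn h v p hst).1
  | _ => exact le_rfl

theorem txProbs_le_half (hn : 2 ≤ n) (h : List (Outcome V)) (v : V) :
    txProbs N n s h v ≤ 1 / 2 := by
  rw [txProbs]
  cases hst : state N n s h v with
  | running p => exact (state_running_bounds N s hn h v p hst).2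
  | _ => simp [NodeState.txProb]

theorem txProbs_nil_le (v : V) :
    txProbs N n s [] v ≤ (n : ℝ)⁻¹ := by
  have hn0 : 0 ≤ (n : ℝ)⁻¹ := by positivity
  rw [txProbs, state]
  split_ifs
  · rw [NodeState.txProb, initProb_one]
    linarith
  · exact hn0

/-- The additive `1/n` pays for the floor in `adjust` and for the initial probability of a newly
informed node. -/
theorem txProbs_cons_le (hn : 2 ≤ n) (o : Outcome V) (h : List (Outcome V)) (v : V) :
    txProbs N n s (o :: h) v ≤ 2 * txProbs N n s h v + (n : ℝ)⁻¹ ∧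
      (v ∈ o.busy → txProbs N n s (o :: h) v ≤ 1 / 2 * txProbs N n s h v + (n : ℝ)⁻¹) := by
  have hn0 : 0 ≤ (n : ℝ)⁻¹ := by positivity
  have h0 := txProbs_nonneg N s hn h v
  rw [txProbs] at h0
  rw [txProbs, txProbs, state]
  cases hst : state N n s h v with
  | asleep =>
    rw [step]
    split_ifs <;> simp only [NodeState.txProb, initProb_one] <;> constructor <;> intros <;> linarith
  | stopped =>
    rw [step]
    simp only [NodeState.txProb]
    constructor <;> intros <;> linarith
  | running p =>
    rw [hst] at h0
    simp only [NodeState.txProb] at h0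
    rw [step]
    split_ifs
    · simp only [NodeState.txProb]
      constructor <;> intros <;> linarith
    · simp only [NodeState.txProb]
      by_cases hb : v ∈ o.busy
      · rw [adjust_busy n hb]
        constructor
        · exact max_le (by linarith) (by linarith)
        · intro
          exact max_le (by linarith) (by linarith)
      · rw [adjust_idle n hb]
        exact ⟨(min_le_left _ _).trans (by linarith), fun h => absurd h hb⟩

variable {s} in
theorem informed_cons {h : List (Outcome V)} {v : V} (hv : (state N n s h v).Informed)
    (o : Outcome V) : (state N n s (o :: h) v).Informed := by
  rw [state]
  cases hst : state N n s h v with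
  | asleep => exact absurd hst hv
  | running p =>
    rw [step]
    split_ifs <;> simp [NodeState.Informed]
  | stopped => simp [step, NodeState.Informed]

theorem informed_of_drop {v : V} : ∀ (τ : ℕ) (h : List (Outcome V)),
    (state N n s (h.drop τ) v).Informed → (state N n s h v).Informed
  | 0, _, hv => hv
  | _ + 1, [], hv => hv
  | τ + 1, o :: h, hv => informed_cons N (informed_of_drop τ h hv) o

theorem stopped_cons {h : List (Outcome V)} {v : V} (hv : state N n s h v = .stopped)
    (o : Outcome V) : state N n s (o :: h) v = .stopped := by
  rw [state, hv, step]

theorem informed_of_rx {o : Outcome V} (h : List (Outcome V)) {v : V} (hv : (o.rx v).Nonempty) :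
    (state N n s (o :: h) v).Informed := by
  by_cases hs : state N n s h v = .asleep
  · rw [state, hs, step]
    split_ifs with h1 h2
    · simp [NodeState.Informed]
    · simp [NodeState.Informed]
    · exact absurd (Or.inl hv) h2
  · exact informed_cons N hs o

theorem stopped_of_ntd {o : Outcome V} (h : List (Outcome V)) {v : V} (hv : (o.rx v).Nonempty)
    (hntd : o.Ntd N v) : state N n s (o :: h) v = .stopped := by
  rw [state]
  cases hst : state N n s h v with
  | asleep => rw [step, if_pos ⟨hv, hntd⟩]
  | running p => rw [step, if_pos (Or.inr ⟨hv, hntd⟩)]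
  | stopped => rw [step]

theorem stopped_of_ack {o : Outcome V} {h : List (Outcome V)} {v : V}
    (hi : (state N n s h v).Informed) (hv : v ∈ o.tx') : state N n s (o :: h) v = .stopped := by
  rw [state]
  cases hst : state N n s h v with
  | asleep => exact absurd hst hi
  | running p => rw [step, if_pos (Or.inl hv)]
  | stopped => rw [step]

/-- A node that is running and was informed before the last round was running then. -/
theorem running_of_cons {o : Outcome V} {h : List (Outcome V)} {v : V} {p' : ℝ}
    (hi : (state N n s h v).Informed) (hp' : state N n s (o :: h) v = .running p') :
    ∃ p, state N n s h v = .running p ∧ p' = adjust n 1 (v ∈ o.busy) p := by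
  rw [state] at hp'
  cases hst : state N n s h v with
  | asleep => exact absurd hst hi
  | running p =>
    rw [hst, step] at hp'
    split_ifs at hp'
    cases hp'
    exact ⟨p, rfl, rfl⟩
  | stopped =>
    rw [hst, step] at hp'
    cases hp'

theorem half_le_adjust (n : ℕ) (b : Prop) {p : ℝ} (hp0 : 0 ≤ p) (hp : p ≤ 1 / 2) :
    1 / 2 * p ≤ adjust n 1 b p := by
  by_cases hb : b
  · rw [adjust_busy n hb]
    exact le_max_of_le_left (by linarith)
  · rw [adjust_idle n hb]
    exact le_min (by linarith) (by linarith)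

theorem informed_of_txProbs_pos {h : List (Outcome V)} {v : V} (hv : 0 < txProbs N n s h v) :
    (state N n s h v).Informed := by
  intro h0
  rw [txProbs, h0] at hv
  exact lt_irrefl _ hv

end States

/-! ### Stopping rules and uninformed neighbours -/

section Stopping

variable {M : Model} {V : Type*} {N : Network M V}

theorem Outcome.mem_tx' {o : Outcome V} {v : V} : v ∈ o.tx' ↔ v ∈ o.tx ∧ v ∈ o.ack := by
  classical
  simp [Outcome.tx']

variable [Fintype V] {ρ : ℝ} {p : V → ℝ} {μ : PMF (Outcome V)}

/-- Only nodes with a nonzero transmission probability transmit. -/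
theorem AdmissibleRound.ne_zero_of_mem_tx (hμ : AdmissibleRound N ρ p μ) {o : Outcome V}
    (ho : o ∈ μ.support) {u : V} (hu : u ∈ o.tx) : p u ≠ 0 := by
  classical
  intro h0
  have h1 := hμ.tx_law o.tx
  rw [Finset.prod_eq_zero (Finset.mem_univ u) (by simp [hu, h0])] at h1
  have h2 : ENNReal.ofReal (prob μ {o' | o'.tx = o.tx}) = 0 := by rw [h1, ENNReal.ofReal_zero]
  rw [ofReal_prob, expect, ENNReal.tsum_eq_zero] at h2
  have h3 := h2 o
  simp only [Set.indicator, Set.mem_ofPred_eq, if_true, Pi.one_apply, mul_one] at h3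
  exact (PMF.mem_support_iff _ _).1 ho h3

/-- A stopped node has no uninformed neighbours. -/
theorem informed_of_stopped {env : List (Outcome V) → PMF (Outcome V)} {n : ℕ} {s : V}
    (hn : 2 ≤ n) (hex : IsExecution N ρ n s env) : ∀ (t : ℕ), ∀ h ∈ (law env t).support, ∀ v,
      state N n s h v = .stopped → ∀ w ∈ N.nbhd v M.ε, (state N n s h w).Informed := by
  intro t
  induction t with
  | zero =>
    intro h hh v hv w hw
    simp only [law, PMF.support_pure, Set.mem_singleton_iff] at hh
    subst hh
    rw [state] at hv
    split_ifs at hv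
  | succ t ih =>
    intro h hh v hv w hw
    obtain ⟨h, hh', o, ho, rfl⟩ := (mem_support_law_succ env).1 hh
    have hadm := hex t h hh'
    have hwd : N.d v w ≤ (1 - M.ε) * M.R := hw
    have hεR := mul_pos M.ε_pos M.R_pos
    -- Every newly stopped node owes this to an acknowledged node `u`, whose first-slot transmission
    -- has reached all of `N(u, ε/2)`.
    have key : ∀ u ∈ o.tx', w ∈ N.nbhd u (M.ε / 2) → (state N n s (o :: h) w).Informed := by
      intro u hu hwu
      rw [Outcome.mem_tx'] at hu
      by_cases hwu' : w = u
      · subst hwu'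
        have := hadm.ne_zero_of_mem_tx ho hu.1
        exact informed_cons N (informed_of_txProbs_pos N s
          (lt_of_le_of_ne (txProbs_nonneg N s hn h w) this.symm)) o
      · exact informed_of_rx N s h ⟨u, ((hadm.ack o ho) u hu.1).2 hu.2 w hwu hwu'⟩
    have self : v ∈ o.tx' → (state N n s (o :: h) w).Informed := fun hv =>
      key v hv (show N.d v w ≤ (1 - M.ε / 2) * M.R by nlinarith)
    -- The distances `εR/2` from `u` to `v` and `(1 - ε)R` from `v` to `w` add up to the radius `(1
    -- - ε/2)R` of `N(u, ε/2)`.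
    have ntd : o.Ntd N v → (state N n s (o :: h) w).Informed := by
      rintro ⟨u, hu, huv⟩
      refine key u (((hadm.slot2 o ho).1 u v hu).1) ?_
      have huv : N.d u v < M.ε / 2 * M.R := huv
      change N.d u w ≤ (1 - M.ε / 2) * M.R
      linarith [N.d_triangle u v w]
    rw [state] at hv
    cases hst : state N n s h v with
    | asleep =>
      rw [hst, step] at hv
      split_ifs at hv with h1
      exact ntd h1.2
    | running p =>
      rw [hst, step] at hv
      split_ifs at hv with h1
      exact h1.elim self fun h => ntd h.2
    | stopped => exact informed_cons N (ih h hh' v hst w hw) o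

end Stopping

/-! # Exponential moments of the contention -/

section Contention

/-- Rate of the exponential moments of the contention. -/
noncomputable def Model.momentRate (M : Model) : ℝ := Real.log M.h1 / 3

/-- Growth rate of the exponential moments of the contention. -/
noncomputable def Model.momentGrowth (M : Model) : ℝ :=
  M.momentRate * (3 * M.phi0 + 1) + Real.log 2

/-- Bound on the average contention. -/
noncomputable def Model.avgContention (M : Model) : ℝ :=
  2 / M.momentRate * (M.momentGrowth + 1)

theorem Model.momentRate_pos (M : Model) : 0 < M.momentRate :=
  div_pos (Real.log_pos M.one_lt_h1) (by norm_num)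

theorem Model.momentRate_le (M : Model) : M.momentRate ≤ M.momentGrowth := by
  have h1 := mul_le_mul_of_nonneg_left
    (show (1 : ℝ) ≤ 3 * M.phi0 + 1 by linarith [M.one_le_phi0]) M.momentRate_pos.le
  have h2 : 0 < Real.log 2 := Real.log_pos (by norm_num)
  rw [Model.momentGrowth]
  linarith

theorem Model.avgContention_pos (M : Model) : 0 < M.avgContention :=
  mul_pos (div_pos two_pos M.momentRate_pos) (by linarith [M.momentRate_pos, M.momentRate_le])

variable {M : Model} {V : Type*} [Fintype V] (N : Network M V) (n : ℕ) (s : V)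

/-- Contention in the close neighbourhood of `x` in the round after a history. -/
noncomputable def contention (x : V) (h : List (Outcome V)) : ℝ :=
  N.closeContention (txProbs N n s h) x

variable {n}

theorem card_mul_inv_le (hcard : Fintype.card V ≤ n) (A : Finset V) :
    (A.card : ℝ) * (n : ℝ)⁻¹ ≤ 1 := by
  rw [← div_eq_mul_inv]
  refine div_le_one_of_le₀ ?_ (Nat.cast_nonneg n)
  exact_mod_cast (Finset.card_le_univ A).trans hcard

theorem contention_nil_le (hcard : Fintype.card V ≤ n) (x : V) : contention N n s x [] ≤ 1 := by
  classical
  refine le_trans ?_ (card_mul_inv_le hcard (Finset.univ.filter fun w => w ∈ ball N.d x (M.R / 2)))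
  rw [← nsmul_eq_mul]
  exact Finset.sum_le_card_nsmul _ _ _ fun w _ => txProbs_nil_le N s w

/-- Since `|V| ≤ n`, the additive terms `1/n` of the individual nodes sum up to at most `1`. -/
theorem contention_cons_le (hn : 2 ≤ n) (hcard : Fintype.card V ≤ n) (x : V) (o : Outcome V)
    (h : List (Outcome V)) : contention N n s x (o :: h) ≤ 2 * contention N n s x h + 1 ∧
      ((∀ w ∈ ball N.d x (M.R / 2), w ∈ o.busy) →
        contention N n s x (o :: h) ≤ 1 / 2 * contention N n s x h + 1) := by
  classical
  have hA := card_mul_inv_le hcard (Finset.univ.filter fun w => w ∈ ball N.d x (M.R / 2))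
  have key : ∀ c : ℝ, (∀ w ∈ ball N.d x (M.R / 2),
      txProbs N n s (o :: h) w ≤ c * txProbs N n s h w + (n : ℝ)⁻¹) →
      contention N n s x (o :: h) ≤ c * contention N n s x h + 1 := by
    intro c hc
    calc contention N n s x (o :: h)
        ≤ ∑ w with w ∈ ball N.d x (M.R / 2), (c * txProbs N n s h w + (n : ℝ)⁻¹) :=
          Finset.sum_le_sum fun w hw => hc w (Finset.mem_filter.1 hw).2
      _ = c * contention N n s x h +
          (Finset.univ.filter fun w => w ∈ ball N.d x (M.R / 2)).card * (n : ℝ)⁻¹ := by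
          rw [Finset.sum_add_distrib, ← Finset.mul_sum, Finset.sum_const, nsmul_eq_mul]
          rfl
      _ ≤ _ := by linarith
  exact ⟨key 2 fun w _ => (txProbs_cons_le N s hn o h w).1,
    fun hb => key (1 / 2) fun w hw => (txProbs_cons_le N s hn o h w).2 (hb w hw)⟩

theorem contention_nonneg (hn : 2 ≤ n) (x : V) (h : List (Outcome V)) :
    0 ≤ contention N n s x h :=
  Finset.sum_nonneg fun w _ => txProbs_nonneg N s hn h w

variable {N s} {ρ : ℝ}

/-- Contention `X > 2φ₀` is halved, up to an additive `1`, outside an event of probability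
`h₁^(-X/2)`, which is small enough to outweigh a doubling. For smaller `X` even a doubling is
harmless. -/
theorem expect_exp_contention_le (hn : 2 ≤ n) (hcard : Fintype.card V ≤ n) (x : V)
    {h : List (Outcome V)} {μ : PMF (Outcome V)}
    (hμ : AdmissibleRound N ρ (txProbs N n s h) μ) :
    expect μ (fun o => ENNReal.ofReal (Real.exp (M.momentRate * contention N n s x (o :: h)))) ≤
      ENNReal.ofReal (Real.exp (M.momentGrowth + M.momentRate / 2 * contention N n s x h)) := by
  have hα := M.momentRate_pos
  set α := M.momentRate with hαdef
  set X := contention N n s x h with hX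
  have hX0 : 0 ≤ X := contention_nonneg N s hn x h
  have hstep := fun o => contention_cons_le N s hn hcard x o h
  rcases le_or_gt X (2 * M.phi0) with hle | hgt
  · refine expect_le_of_le fun o _ => ENNReal.ofReal_le_ofReal (Real.exp_le_exp.2 ?_)
    have h1 := mul_le_mul_of_nonneg_left (hstep o).1 hα.le
    have h2 := mul_le_mul_of_nonneg_left hle hα.le
    have h3 : 0 < Real.log 2 := Real.log_pos (by norm_num)
    rw [Model.momentGrowth]
    nlinarith
  · have hbusy := hμ.cd_busy x (X / 2) (by linarith)
      (show X / 2 < X by linarith [M.one_le_phi0])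
    refine (expect_le_of_prob_le (A := Real.exp (α * (1 / 2 * X + 1)))
      (B := Real.exp (α * (2 * X + 1))) (Real.exp_pos _).le
      (Real.exp_le_exp.2 (mul_le_mul_of_nonneg_left (by linarith) hα.le)) hbusy
      (fun o _ ho => Real.exp_le_exp.2 (mul_le_mul_of_nonneg_left ((hstep o).2 ho) hα.le))
      (fun o _ => Real.exp_le_exp.2 (mul_le_mul_of_nonneg_left (hstep o).1 hα.le))).trans
      (ENNReal.ofReal_le_ofReal ?_)
    -- The `1/3` in the rate `α` is made for this: the factor `exp(-3αX/2)` turns the exponent `2αX`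
    -- of a doubling into the exponent `αX/2` of a halving.
    have hpow : M.h1 ^ (-(X / 2)) = Real.exp (-(3 / 2 * α * X)) := by
      rw [Real.rpow_def_of_pos (by linarith [M.one_lt_h1])]
      congr 1
      rw [hαdef, Model.momentRate]
      ring
    have e1 : Real.exp (-(3 / 2 * α * X)) * Real.exp (α * (2 * X + 1)) =
        Real.exp (α * (1 / 2 * X + 1)) := by
      rw [← Real.exp_add]
      congr 1
      ring
    have e2 : 2 * Real.exp (α * (1 / 2 * X + 1)) ≤
        Real.exp (M.momentGrowth + α / 2 * X) := by
      rw [← Real.exp_log (show (0 : ℝ) < 2 by norm_num), ← Real.exp_add,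
        Real.exp_log (show (0 : ℝ) < 2 by norm_num), Real.exp_le_exp, Model.momentGrowth]
      nlinarith [mul_nonneg hα.le (show 0 ≤ 3 * M.phi0 by linarith [M.one_le_phi0])]
    have e3 : 0 ≤ Real.exp (-(3 / 2 * α * X)) * Real.exp (α * (1 / 2 * X + 1)) := by positivity
    rw [hpow]
    nlinarith

/-- By `2ab ≤ a² + b²` the one-round bound `e^γ * e^(αX/2)` is at most the mean of `e^(αX)` and
`e^(2γ)`, so the bound `e^(2γ)` is preserved. -/
theorem expect_exp_contention_law_le {env : List (Outcome V) → PMF (Outcome V)} (hn : 2 ≤ n)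
    (hcard : Fintype.card V ≤ n) (hex : IsExecution N ρ n s env) (x : V) (t : ℕ) :
    expect (law env t) (fun h => ENNReal.ofReal (Real.exp (M.momentRate * contention N n s x h))) ≤
      ENNReal.ofReal (Real.exp (2 * M.momentGrowth)) := by
  have hα := M.momentRate_pos
  have hγ := M.momentRate_le
  induction t with
  | zero =>
    rw [law, expect_pure]
    refine ENNReal.ofReal_le_ofReal (Real.exp_le_exp.2 ?_)
    have := mul_le_mul_of_nonneg_left (contention_nil_le N s hcard x) hα.le
    linarith
  | succ t ih =>
    rw [expect_law_succ]
    refine (expect_mono fun h hh => (expect_exp_contention_le hn hcard x (hex t h hh)).trans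
      (ENNReal.ofReal_le_ofReal (show _ ≤ 1 / 2 * Real.exp (M.momentRate * contention N n s x h) +
        1 / 2 * Real.exp (2 * M.momentGrowth) from ?_))).trans ?_
    · have e1 : Real.exp (M.momentRate * contention N n s x h) =
          Real.exp (M.momentRate / 2 * contention N n s x h) ^ 2 := by
        rw [← Real.exp_nat_mul]
        congr 1
        push_cast
        ring
      have e2 : Real.exp (2 * M.momentGrowth) = Real.exp M.momentGrowth ^ 2 := by
        rw [← Real.exp_nat_mul]
        norm_num
      rw [e1, e2, Real.exp_add]
      nlinarith [sq_nonneg (Real.exp M.momentGrowth -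
        Real.exp (M.momentRate / 2 * contention N n s x h))]
    · simp only [ENNReal.ofReal_add (mul_nonneg (by norm_num : (0 : ℝ) ≤ 1 / 2)
        (Real.exp_pos _).le) (mul_nonneg (by norm_num : (0 : ℝ) ≤ 1 / 2) (Real.exp_pos _).le),
        ENNReal.ofReal_mul (by norm_num : (0 : ℝ) ≤ 1 / 2)]
      rw [expect_add, expect_const_mul, expect_const, ← mul_add,
        show ENNReal.ofReal (1 / 2) = 2⁻¹ by
          rw [one_div, ENNReal.ofReal_inv_of_pos two_pos, ENNReal.ofReal_ofNat]]
      refine (mul_le_mul_right (add_le_add_left ih _) _).trans_eq ?_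
      rw [← two_mul, ← mul_assoc, ENNReal.inv_mul_cancel (by norm_num) (by norm_num), one_mul]

/-- The average contention of a close neighbourhood during `L` rounds is bounded. -/
theorem prob_windowSum_contention_le {env : List (Outcome V) → PMF (Outcome V)} (hn : 2 ≤ n)
    (hcard : Fintype.card V ≤ n) (hex : IsExecution N ρ n s env) (x : V) (T L : ℕ) :
    prob (law env (T + L)) {h | M.avgContention * L < windowSum (contention N n s x) L h} ≤
      Real.exp (2 * M.momentGrowth - L) := by
  have hα := M.momentRate_pos
  set α := M.momentRate with hαdef
  set γ := M.momentGrowth with hγdef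
  -- A supermartingale: in expectation each round gives up half of the exponent `αX` at the cost of
  -- `γ`, and that half is entered into the sum over the window.
  have h1 := expect_law_add_le env T (fun τ h => ENNReal.ofReal (Real.exp
    (α * contention N n s x h + α / 2 * windowSum (contention N n s x) τ h - γ * τ))) (by
      intro τ h hh
      have e : ∀ o, Real.exp (α * contention N n s x (o :: h) +
          α / 2 * windowSum (contention N n s x) (τ + 1) (o :: h) - γ * (τ + 1 : ℕ)) =
          Real.exp (α / 2 * (contention N n s x h + windowSum (contention N n s x) τ h) -
            γ * (τ + 1 : ℕ)) * Real.exp (α * contention N n s x (o :: h)) := by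
        intro o
        rw [windowSum_succ_cons, ← Real.exp_add]
        congr 1
        ring
      simp only [e, ENNReal.ofReal_mul (Real.exp_pos _).le]
      rw [expect_const_mul]
      refine (mul_le_mul_right (expect_exp_contention_le hn hcard x (hex _ h hh)) _).trans_eq ?_
      rw [← ENNReal.ofReal_mul (Real.exp_pos _).le, ← Real.exp_add]
      congr 2
      push_cast
      ring) L
  simp only [windowSum_zero, mul_zero, Nat.cast_zero, add_zero, sub_zero] at h1
  -- Markov's inequality; by the choice of `avgContention` the exponent of the threshold equals `L`.
  refine (prob_le_div (Real.exp_pos (α / 2 * (M.avgContention * L) - γ * L)) (Real.exp_pos _).le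
    ?_ (h1.trans (expect_exp_contention_law_le hn hcard hex x T))).trans_eq ?_
  · intro h _ hE
    have hE : M.avgContention * L < windowSum (contention N n s x) L h := hE
    refine ENNReal.ofReal_le_ofReal (Real.exp_le_exp.2 ?_)
    have h2 := mul_le_mul_of_nonneg_left hE.le (half_pos hα).le
    have h3 := mul_nonneg hα.le (contention_nonneg N s hn x h)
    linarith
  · rw [← Real.exp_sub]
    congr 1
    rw [Model.avgContention, ← hαdef, ← hγdef]
    field_simp
    ring

end Contention

/-! # Consequences of the independence of the transmitters -/

section FiniteSums

variable {α ι : Type*}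

theorem expect_finset_sum (μ : PMF α) (s : Finset ι) (g : ι → α → ℝ≥0∞) :
    expect μ (fun a => ∑ i ∈ s, g i a) = ∑ i ∈ s, expect μ (g i) := by
  classical
  induction s using Finset.induction_on with
  | empty => simp [expect_const]
  | insert i s hi ih => simp only [Finset.sum_insert hi, expect_add, ih]

theorem prob_exists_eq (μ : PMF α) (s : Finset ι) (E : ι → Set α)
    (hE : ∀ i ∈ s, ∀ j ∈ s, ∀ a, a ∈ E i → a ∈ E j → i = j) :
    prob μ {a | ∃ i ∈ s, a ∈ E i} = ∑ i ∈ s, prob μ (E i) := by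
  classical
  refine le_antisymm (prob_exists_le μ s E) ?_
  rw [← ENNReal.ofReal_le_ofReal_iff (prob_nonneg _ _), ENNReal.ofReal_sum_of_nonneg
    fun i _ => prob_nonneg _ _]
  simp only [ofReal_prob]
  rw [← expect_finset_sum]
  refine expect_mono fun a _ => ?_
  by_cases h : ∃ i ∈ s, a ∈ E i
  · obtain ⟨i, hi, hai⟩ := h
    rw [Finset.sum_eq_single_of_mem i hi]
    · have : a ∈ {a | ∃ i ∈ s, a ∈ E i} := ⟨i, hi, hai⟩
      simp [hai, this]
    · intro j hj hji
      have : a ∉ E j := fun haj => hji (hE j hj i hi a haj hai)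
      simp [this]
  · rw [Finset.sum_eq_zero]
    · simp
    · intro j hj
      have : a ∉ E j := fun haj => h ⟨j, hj, haj⟩
      simp [this]

end FiniteSums

section Transmitters

variable {M : Model} {V : Type*} [Fintype V] {N : Network M V} {ρ : ℝ} {p : V → ℝ}
  {μ : PMF (Outcome V)}

/-- The nodes of `U` that transmit are those of `B`. -/
def txEvent (U : Finset V) (B : Set V) : Set (Outcome V) := {o | ∀ v ∈ U, v ∈ o.tx ↔ v ∈ B}

-- Marginalization of the joint law. Expanding `∏ v, (f v + g v)` runs through all transmitter sets;
-- `f` and `g` vanish on the choices that contradict `B` on `U`, and `f v + g v = 1` outside `U`.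
open Classical in
theorem AdmissibleRound.prob_txEvent (hμ : AdmissibleRound N ρ p μ) (U : Finset V) (B : Set V) :
    prob μ (txEvent U B) = ∏ v ∈ U, if v ∈ B then p v else 1 - p v := by
  have h1 : prob μ (txEvent U B) =
      ∑ A with ∀ v ∈ U, v ∈ A ↔ v ∈ B, prob μ {o | o.tx = A} := by
    rw [← prob_exists_eq]
    · congr 1
      ext o
      simp [txEvent]
    · intro A _ A' _ o hA hA'
      exact hA.symm.trans hA'
  set f : V → ℝ := fun v => if v ∈ U → v ∈ B then p v else 0
  set g : V → ℝ := fun v => if v ∈ U → v ∉ B then 1 - p v else 0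
  have h2 : ∀ A : Finset V, ((∏ v ∈ A, f v) * ∏ v ∈ Finset.univ \ A, g v) =
      if ∀ v ∈ U, v ∈ A ↔ v ∈ B then prob μ {o | o.tx = A} else 0 := by
    intro A
    have h3 := Finset.prod_piecewise Finset.univ A f g
    rw [Finset.univ_inter] at h3
    rw [← h3]
    split_ifs with hA
    · rw [hμ.tx_law A]
      refine Finset.prod_congr rfl fun v _ => ?_
      by_cases hv : v ∈ A
      · have : v ∈ U → v ∈ B := fun hU => (hA v hU).1 hv
        simp only [hv, Finset.piecewise_eq_of_mem, if_true, f]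
        rw [if_pos this]
      · have : v ∈ U → v ∉ B := fun hU hB => hv ((hA v hU).2 hB)
        simp only [hv, not_false_eq_true, Finset.piecewise_eq_of_notMem, if_false, g]
        rw [if_pos this]
    · push Not at hA
      obtain ⟨v, hvU, hv⟩ := hA
      refine Finset.prod_eq_zero (Finset.mem_univ v) ?_
      by_cases hvA : v ∈ A
      · have hB : v ∉ B := by tauto
        simp [hvA, f, hvU, hB]
      · have hB : v ∈ B := by tauto
        simp [hvA, g, hvU, hB]
  rw [h1, Finset.sum_filter, ← Finset.sum_congr rfl fun A _ => h2 A, ← Finset.powerset_univ,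
    ← Finset.prod_add f g Finset.univ, ← Finset.prod_subset (Finset.subset_univ U)]
  · refine Finset.prod_congr rfl fun v hv => ?_
    by_cases hB : v ∈ B <;> simp [f, g, hv, hB]
  · intro v _ hv
    simp [f, g, hv]

theorem AdmissibleRound.prob_mem_tx_inter (hμ : AdmissibleRound N ρ p μ) (U : Finset V)
    (B : Set V) {w : V} (hw : w ∉ U) :
    prob μ (txEvent U B ∩ {o | w ∈ o.tx}) = p w * prob μ (txEvent U B) := by
  classical
  have h1 : txEvent U B ∩ {o | w ∈ o.tx} = txEvent (insert w U) (insert w B) := by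
    ext o
    simp only [txEvent, Set.mem_inter_iff, Set.mem_ofPred_eq, Finset.mem_insert, Set.mem_insert_iff,
      forall_eq_or_imp, true_or, iff_true]
    constructor
    · rintro ⟨h, hwo⟩
      exact ⟨hwo, fun v hv => by rw [h v hv, or_iff_right (fun e : v = w => hw (e ▸ hv))]⟩
    · rintro ⟨hwo, h⟩
      exact ⟨fun v hv => by rw [h v hv, or_iff_right (fun e : v = w => hw (e ▸ hv))], hwo⟩
  rw [h1, hμ.prob_txEvent, hμ.prob_txEvent, Finset.prod_insert hw]
  congr 1
  · simp
  · refine Finset.prod_congr rfl fun v hv => ?_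
    have : v ≠ w := fun e => hw (e ▸ hv)
    simp [this]

open Classical in
/-- Markov's inequality for the interference from outside of `U`, which is independent of the
transmitters in `U`. -/
theorem AdmissibleRound.prob_interference_ge (hμ : AdmissibleRound N ρ p μ) (hp : ∀ w, 0 ≤ p w)
    (U : Finset V) (B : Set V) {g : V → ℝ} (hg : ∀ w, 0 ≤ g w) {c : ℝ} (hc : 0 < c) :
    prob μ (txEvent U B ∩ {o | c ≤ ∑ w ∈ o.tx with w ∉ U, g w}) ≤
      prob μ (txEvent U B) * (∑ w with w ∉ U, p w * g w) / c := by
  refine prob_le_div (g := fun o => ∑ w with w ∉ U,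
    ENNReal.ofReal (g w) * (txEvent U B ∩ {o | w ∈ o.tx}).indicator 1 o) hc
    (mul_nonneg (prob_nonneg _ _) (Finset.sum_nonneg fun w _ => mul_nonneg (hp w) (hg w))) ?_ ?_
  · rintro o - ⟨ho, hco⟩
    have hco : c ≤ ∑ w ∈ o.tx with w ∉ U, g w := hco
    refine (ENNReal.ofReal_le_ofReal hco).trans ?_
    rw [ENNReal.ofReal_sum_of_nonneg fun w _ => hg w]
    have hsub : (o.tx.filter fun w => w ∉ U) ⊆ Finset.univ.filter fun w => w ∉ U :=
      Finset.filter_subset_filter _ (Finset.subset_univ _)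
    refine (Finset.sum_le_sum fun w hw => ?_).trans
      (Finset.sum_le_sum_of_subset_of_nonneg hsub fun _ _ _ => bot_le)
    have : o ∈ txEvent U B ∩ {o | w ∈ o.tx} := ⟨ho, (Finset.mem_filter.1 hw).1⟩
    rw [Set.indicator_of_mem this]
    simp
  · rw [expect_finset_sum, Finset.mul_sum, ENNReal.ofReal_sum_of_nonneg fun w _ =>
      mul_nonneg (prob_nonneg _ _) (mul_nonneg (hp w) (hg w))]
    refine Finset.sum_le_sum fun w hw => ?_
    rw [expect_const_mul, ← ofReal_prob, hμ.prob_mem_tx_inter U B (Finset.mem_filter.1 hw).2,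
      ← ENNReal.ofReal_mul (hg w)]
    exact le_of_eq (congrArg _ (by ring))

open Classical in
theorem AdmissibleRound.le_prob_interference_lt (hμ : AdmissibleRound N ρ p μ) (hp : ∀ w, 0 ≤ p w)
    (U : Finset V) (B : Set V) {g : V → ℝ} (hg : ∀ w, 0 ≤ g w) {c δ : ℝ} (hc : 0 < c)
    (hδ : ∑ w with w ∉ U, p w * g w ≤ δ * c) :
    prob μ (txEvent U B) * (1 - δ) ≤
      prob μ (txEvent U B ∩ {o | ∑ w ∈ o.tx with w ∉ U, g w < c}) := by
  have h1 := hμ.prob_interference_ge hp U B hg hc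
  have h2 : prob μ (txEvent U B) ≤
      prob μ (txEvent U B ∩ {o | ∑ w ∈ o.tx with w ∉ U, g w < c}) +
      prob μ (txEvent U B ∩ {o | c ≤ ∑ w ∈ o.tx with w ∉ U, g w}) := by
    refine (prob_mono fun o _ ho => ?_).trans (prob_union_le _ _ _)
    rcases lt_or_ge (∑ w ∈ o.tx with w ∉ U, g w) c with h | h
    · exact Or.inl ⟨ho, h⟩
    · exact Or.inr ⟨ho, h⟩
  have h3 : prob μ (txEvent U B) * (∑ w with w ∉ U, p w * g w) / c ≤
      prob μ (txEvent U B) * δ := by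
    rw [div_le_iff₀ hc, mul_assoc]
    exact mul_le_mul_of_nonneg_left hδ (prob_nonneg _ _)
  linarith

theorem exp_neg_two_mul_le {x : ℝ} (h0 : 0 ≤ x) (h : x ≤ 1 / 2) : Real.exp (-(2 * x)) ≤ 1 - x := by
  rw [Real.exp_neg]
  refine inv_le_of_inv_le₀ (by linarith) (le_trans ?_ (Real.add_one_le_exp _))
  rw [inv_le_iff_one_le_mul₀ (by linarith)]
  nlinarith

theorem AdmissibleRound.le_prob_txEvent_singleton (hμ : AdmissibleRound N ρ p μ)
    (hp : ∀ w, 0 ≤ p w) (hp' : ∀ w, p w ≤ 1 / 2) {U : Finset V} {u : V} (hu : u ∈ U) :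
    p u * Real.exp (-(2 * ∑ w ∈ U, p w)) ≤ prob μ (txEvent U {u}) := by
  classical
  rw [hμ.prob_txEvent, ← Finset.mul_prod_erase U _ hu]
  simp only [Set.mem_singleton_iff, if_true]
  refine mul_le_mul_of_nonneg_left ?_ (hp u)
  calc Real.exp (-(2 * ∑ w ∈ U, p w)) ≤ Real.exp (∑ w ∈ U.erase u, -(2 * p w)) := by
        rw [Finset.sum_neg_distrib, ← Finset.mul_sum, Real.exp_le_exp, neg_le_neg_iff]
        exact mul_le_mul_of_nonneg_left (Finset.sum_le_sum_of_subset_of_nonneg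
          (Finset.erase_subset _ _) fun w _ _ => hp w) (by norm_num)
    _ = ∏ w ∈ U.erase u, Real.exp (-(2 * p w)) := Real.exp_sum _ _
    _ ≤ _ := by
        refine Finset.prod_le_prod (fun w _ => (Real.exp_pos _).le) fun w hw => ?_
        rw [if_neg (Finset.ne_of_mem_erase hw)]
        exact exp_neg_two_mul_le (hp w) (hp' w)

open Classical in
/-- With probability bounded from below, exactly one node of `U` transmits, it belongs to `D`, and
the interference from outside of `U` is small. -/
theorem AdmissibleRound.le_prob_unique_transmitter (hμ : AdmissibleRound N ρ p μ)
    (hp : ∀ w, 0 ≤ p w) (hp' : ∀ w, p w ≤ 1 / 2) {D U : Finset V} (hDU : D ⊆ U) {g : V → ℝ}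
    (hg : ∀ w, 0 ≤ g w) {c a b : ℝ} (hc : 0 < c) (hgc : ∑ w with w ∉ U, p w * g w ≤ 1 / 2 * c)
    (ha : a ≤ ∑ w ∈ D, p w) (hb : ∑ w ∈ U, p w ≤ b) :
    1 / 2 * a * Real.exp (-(2 * b)) ≤ prob μ {o | ∃ u ∈ D,
      o ∈ txEvent U {u} ∩ {o | ∑ w ∈ o.tx with w ∉ U, g w < c}} := by
  -- The events for different `u` are disjoint, so their probabilities add up and the bound is
  -- proportional to the contention of `D`.
  rw [prob_exists_eq]
  · calc 1 / 2 * a * Real.exp (-(2 * b)) = a * (Real.exp (-(2 * b)) * (1 - 1 / 2)) := by ring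
      _ ≤ (∑ w ∈ D, p w) * (Real.exp (-(2 * b)) * (1 - 1 / 2)) :=
          mul_le_mul_of_nonneg_right ha (by positivity)
      _ = ∑ u ∈ D, p u * Real.exp (-(2 * b)) * (1 - 1 / 2) := by
          rw [Finset.sum_mul]
          exact Finset.sum_congr rfl fun _ _ => by ring
      _ ≤ _ := by
          refine Finset.sum_le_sum fun u hu => ?_
          refine le_trans (mul_le_mul_of_nonneg_right ?_ (by norm_num))
            (hμ.le_prob_interference_lt hp U {u} hg hc hgc)
          refine le_trans (mul_le_mul_of_nonneg_left (Real.exp_le_exp.2 ?_) (hp u))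
            (hμ.le_prob_txEvent_singleton hp hp' (hDU hu))
          linarith
  · intro i hi j hj o hoi hoj
    have h1 := (hoi.1 i (hDU hi)).2 rfl
    exact (hoj.1 i (hDU hi)).1 h1

open Classical in
/-- The interference from outside of the vicinity is small with probability at least `1 - δ`. -/
theorem AdmissibleRound.le_prob_farInterference_lt (hμ : AdmissibleRound N ρ p μ)
    (hp : ∀ w, 0 ≤ p w) (ρ' : ℝ) (v : V) {c δ : ℝ} (hc : 0 < c)
    (h : N.farWeight ρ' p v ≤ δ * c) :
    1 - δ ≤ prob μ {o | N.farInterference ρ' o.tx v < c} := by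
  have h1 := hμ.le_prob_interference_lt hp ∅ ∅
    (g := fun w => if w ∉ N.vicinity v ρ' then N.signal w v else 0)
    (fun w => by split_ifs; exacts [le_rfl, N.signal_nonneg w v]) hc (δ := δ) (by
      refine le_trans (le_of_eq ?_) h
      simp [Network.farWeight, Finset.sum_filter])
  rw [hμ.prob_txEvent, Finset.prod_empty, one_mul] at h1
  refine h1.trans (prob_mono fun o _ ho =>
    show N.farInterference ρ' o.tx v < c from lt_of_eq_of_lt ?_ ho.2)
  simp [Network.farInterference, Finset.sum_filter]

end Transmitters

/-! # Successful transmissions -/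

section Success

variable {M : Model} {V : Type*} (N : Network M V)

theorem Network.interference_mono {S S' : Finset V} (h : S ⊆ S') (u : V) :
    N.interference S u ≤ N.interference S' u := by
  classical
  exact Finset.sum_le_sum_of_subset_of_nonneg (Finset.filter_subset_filter _ h) fun w _ _ =>
    N.signal_nonneg w u

/-- Interference threshold for successful acknowledged transmissions. -/
noncomputable def Model.clearThreshold (M : Model) : ℝ :=
  min (M.Ic (M.ε / 2)) (M.Iack (M.ε / 2)) / 2 ^ M.ζ

theorem Model.clearThreshold_pos (M : Model) : 0 < M.clearThreshold :=
  div_pos (lt_min (M.Ic_pos _) (M.Iack_pos _)) (by positivity)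

variable {N}

theorem SuccClear.mem_rx {S : Finset V} {rx : V → Finset V} {δ : ℝ} (h : SuccClear N δ S rx)
    {u v : V} (hu : u ∈ S) (halone : ∀ w ∈ S, w ∈ N.vicinity u (M.rhoc δ) → w = u)
    (hI : N.interference S u ≤ M.Ic δ) (hv : v ∈ N.nbhd u δ) (hvu : v ≠ u) : u ∈ rx v :=
  h.2 u hu halone hI v hv hvu

/-- The triangle inequality gives `d(w,u) ≥ d(w,v)/2`. Hence far interference need only be
controlled at the centre `v`, whichever `u` near it transmits; the factor `2^ζ` is built into
`clearThreshold`. -/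
theorem Network.signal_le_two_rpow_mul {u v w : V} {r : ℝ} (hr : 0 < r) (hu : N.d u v < r)
    (hw : 2 * r ≤ N.d w v) : N.signal w u ≤ 2 ^ M.ζ * N.signal w v := by
  have hwv : w ≠ v := by
    rintro rfl
    rw [N.d_self] at hw
    linarith
  have hd : 0 < N.d w v := by linarith
  have h1 : N.d w v / 2 ≤ N.d w u := by linarith [N.d_triangle w u v]
  refine (N.signal_le (half_pos hd) h1).trans_eq ?_
  rw [N.signal_eq hwv, Real.div_rpow hd.le zero_le_two, Real.rpow_neg zero_le_two]
  field_simp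

variable [Fintype V] {n : ℕ} {s : V} {ρ : ℝ} {h : List (Outcome V)} {μ : PMF (Outcome V)}

/-- After a clear transmission of `u`, all nodes close to `u` have stopped. -/
theorem stopped_of_clear (hn : 2 ≤ n) (hμ : AdmissibleRound N ρ (txProbs N n s h) μ)
    {o : Outcome V} (ho : o ∈ μ.support) {u : V} (hu : u ∈ o.tx)
    (halone : ∀ w ∈ o.tx, w ∈ N.vicinity u (M.rhoc (M.ε / 2)) → w = u)
    (hc : N.interference o.tx u ≤ M.Ic (M.ε / 2))
    (hack : N.interference o.tx u ≤ M.Iack (M.ε / 2)) {w : V}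
    (hw : N.d u w < M.ε / 2 * M.R) : state N n s (o :: h) w = .stopped := by
  have hrx : ∀ v ∈ N.nbhd u (M.ε / 2), v ≠ u → u ∈ o.rx v := fun v hv hvu =>
    (hμ.slot1 o ho).mem_rx hu halone hc hv hvu
  have hu' : u ∈ o.tx' := Outcome.mem_tx'.2 ⟨hu, (hμ.ack o ho u hu).1 hrx hack⟩
  have hsub : o.tx' ⊆ o.tx := fun v hv => (Outcome.mem_tx'.1 hv).1
  by_cases hwu : w = u
  · subst hwu
    refine stopped_of_ack N s (informed_of_txProbs_pos N s ?_) hu'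
    exact lt_of_le_of_ne (txProbs_nonneg N s hn h w) (hμ.ne_zero_of_mem_tx ho hu).symm
  · have hw' : w ∈ N.nbhd u (M.ε / 2) := by
      have := mul_lt_mul_of_pos_right M.ε_lt_one M.R_pos
      change N.d u w ≤ (1 - M.ε / 2) * M.R
      linarith
    -- The second slot has no new transmitters, so the channel of `u` is still clear, and NTD has
    -- outcome `1` at `w`.
    have h2 : u ∈ o.rx' w := (hμ.slot2 o ho).mem_rx hu' (fun x hx => halone x (hsub hx))
      ((N.interference_mono hsub u).trans hc) hw' hwu
    exact stopped_of_ntd N s h ⟨u, hrx w hw' hwu⟩ ⟨u, h2, hw⟩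

open Classical in
/-- If only `u ∈ D_v^ρ` transmits in `D_v^{ρ₁}` and there is little interference from outside, all
nodes close to `u` stop. -/
theorem stopped_of_unique_transmitter (hn : 2 ≤ n)
    (hμ : AdmissibleRound N ρ (txProbs N n s h) μ) {o : Outcome V} (ho : o ∈ μ.support) {u v : V}
    {ρ₁ : ℝ} (hρ : 0 < ρ) (h2ρ : 2 * ρ ≤ ρ₁) (hρc : ρ + M.rhoc (M.ε / 2) ≤ ρ₁)
    (huv : u ∈ N.vicinity v ρ)
    (htx : o ∈ txEvent (Finset.univ.filter fun w => w ∈ N.vicinity v ρ₁) {u})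
    (hI : ∑ w ∈ o.tx with w ∉ Finset.univ.filter fun w => w ∈ N.vicinity v ρ₁, N.signal w v <
      M.clearThreshold) {w : V}
    (hw : N.d u w < M.ε / 2 * M.R) : state N n s (o :: h) w = .stopped := by
  have hR := M.R_pos
  have huv' : N.d u v < ρ * M.R := huv
  have hmem : ∀ {w r}, r ≤ ρ₁ → N.d w v < r * M.R →
      w ∈ Finset.univ.filter fun w => w ∈ N.vicinity v ρ₁ := by
    intro w r hr hwr
    refine Finset.mem_filter.2 ⟨Finset.mem_univ _, ?_⟩
    exact hwr.trans_le (mul_le_mul_of_nonneg_right hr hR.le)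
  have hu : u ∈ o.tx := (htx u (hmem (by linarith) huv')).2 rfl
  have hle : N.interference o.tx u ≤ min (M.Ic (M.ε / 2)) (M.Iack (M.ε / 2)) := by
    have hthr : 2 ^ M.ζ * M.clearThreshold = min (M.Ic (M.ε / 2)) (M.Iack (M.ε / 2)) := by
      rw [Model.clearThreshold, mul_div_cancel₀]
      positivity
    rw [← hthr]
    refine le_trans ?_ (mul_le_mul_of_nonneg_left hI.le (by positivity))
    rw [Finset.mul_sum, Network.interference]
    have hout : ∀ w ∈ o.tx, w ≠ u → w ∉ Finset.univ.filter fun w => w ∈ N.vicinity v ρ₁ :=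
      fun w hw hwu hwU => hwu ((htx w hwU).1 hw)
    refine (Finset.sum_le_sum fun w hw => ?_).trans (Finset.sum_le_sum_of_subset_of_nonneg
      (fun w hw => ?_) fun w _ _ => mul_nonneg (by positivity) (N.signal_nonneg w v))
    · rw [Finset.mem_filter] at hw
      refine N.signal_le_two_rpow_mul (mul_pos hρ hR) huv' ?_
      have : w ∉ N.vicinity v ρ₁ := fun hwv => hout w hw.1 hw.2 (by simpa using hwv)
      have h1 : ρ₁ * M.R ≤ N.d w v := not_lt.1 this
      nlinarith
    · rw [Finset.mem_filter] at hw ⊢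
      exact ⟨hw.1, hout w hw.1 hw.2⟩
  refine stopped_of_clear hn hμ ho hu (fun x hx hxu => ?_) (hle.trans (min_le_left _ _))
    (hle.trans (min_le_right _ _)) hw
  refine (htx x (hmem hρc ?_)).1 hx
  have hxu : N.d x u < M.rhoc (M.ε / 2) * M.R := hxu
  linarith [N.d_triangle x u v]

end Success

/-! # Nodes that have not stopped -/

section Active

variable {M : Model} {V : Type*} [Fintype V] (N : Network M V) (n : ℕ) (s : V) (ρ : ℝ) (v : V)

open Classical in
/-- The sets of separated nodes of `D_v^ρ` that have not stopped. -/
noncomputable def activeSets (h : List (Outcome V)) : Finset (Finset V) :=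
  Finset.univ.filter fun S => N.IsSeparated S ∧
    ∀ u ∈ S, u ∈ N.vicinity v ρ ∧ state N n s h u ≠ .stopped

/-- The largest number of separated nodes of `D_v^ρ` that have not stopped. -/
noncomputable def activePacking (h : List (Outcome V)) : ℕ :=
  (activeSets N n s ρ v h).sup Finset.card

variable {N n s ρ v}

theorem mem_activeSets {h : List (Outcome V)} {S : Finset V} :
    S ∈ activeSets N n s ρ v h ↔ N.IsSeparated S ∧
      ∀ u ∈ S, u ∈ N.vicinity v ρ ∧ state N n s h u ≠ .stopped := by
  simp [activeSets]

theorem exists_card_eq_activePacking (h : List (Outcome V)) :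
    ∃ S ∈ activeSets N n s ρ v h, activePacking N n s ρ v h = S.card :=
  Finset.exists_mem_eq_sup _ ⟨∅, mem_activeSets.2 (by simp [Network.IsSeparated])⟩ _

/-- This is why only separated nodes are counted: the number of all nodes in the vicinity need not
be bounded by a constant of the model. -/
theorem activePacking_le (hρ : 0 ≤ ρ) (h : List (Outcome V)) :
    (activePacking N n s ρ v h : ℝ) ≤ M.packBound (ρ * M.R) := by
  obtain ⟨S, hS, hcard⟩ := exists_card_eq_activePacking (N := N) (n := n) (s := s) (ρ := ρ) (v := v) h
  rw [mem_activeSets] at hS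
  rw [hcard]
  exact hS.1.card_le (mul_nonneg hρ M.R_pos.le) fun u hu => (hS.2 u hu).1

theorem activePacking_cons_le (o : Outcome V) (h : List (Outcome V)) :
    activePacking N n s ρ v (o :: h) ≤ activePacking N n s ρ v h := by
  refine Finset.sup_mono fun S hS => ?_
  rw [mem_activeSets] at hS ⊢
  exact ⟨hS.1, fun u hu => ⟨(hS.2 u hu).1, fun hst => (hS.2 u hu).2 (stopped_cons N s hst o)⟩⟩

/-- Nodes that have not stopped after the round are at distance at least `εR/2 ≥ 2 rmin` from `u`,
so `u` can be added to a maximum separated set of them, giving a larger set of nodes that had not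
stopped before the round. -/
theorem activePacking_cons_lt {o : Outcome V} {h : List (Outcome V)} {u : V}
    (huv : u ∈ N.vicinity v ρ) (hu : state N n s h u ≠ .stopped)
    (hclose : ∀ w, N.d u w < M.ε / 2 * M.R → state N n s (o :: h) w = .stopped) :
    activePacking N n s ρ v (o :: h) + 1 ≤ activePacking N n s ρ v h := by
  classical
  obtain ⟨S, hS, hcard⟩ := exists_card_eq_activePacking (N := N) (n := n) (s := s) (ρ := ρ) (v := v)
    (o :: h)
  rw [mem_activeSets] at hS
  have hεR := mul_pos M.ε_pos M.R_pos
  have huS : u ∉ S := fun huS => (hS.2 u huS).2 (hclose u (by rw [N.d_self]; linarith))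
  have hdisj : ∀ x ∈ S, Disjoint (ball N.d u M.rmin) (ball N.d x M.rmin) := by
    intro x hx
    rw [Set.disjoint_left]
    intro z hzu hzx
    simp only [ball, Set.mem_ofPred_eq, max_lt_iff] at hzx hzu
    refine (hS.2 x hx).2 (hclose x ?_)
    linarith [N.d_triangle u z x, M.rmin_le]
  rw [hcard, ← Finset.card_insert_of_notMem huS]
  refine Finset.le_sup (f := Finset.card) (mem_activeSets.2 ⟨?_, ?_⟩)
  · intro x hx y hy hxy
    rcases Finset.mem_insert.1 hx with hx | hx <;> rcases Finset.mem_insert.1 hy with hy | hy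
    · exact absurd (hx.trans hy.symm) hxy
    · exact hx ▸ hdisj y hy
    · exact hy ▸ (hdisj x hx).symm
    · exact hS.1 x hx y hy hxy
  · intro x hx
    rcases Finset.mem_insert.1 hx with hx | hx
    · exact hx ▸ ⟨huv, hu⟩
    · exact ⟨(hS.2 x hx).1, fun hst => (hS.2 x hx).2 (stopped_cons N s hst o)⟩

end Active

/-! # Drift of the transmission probability -/

section Drift

variable {M : Model} {V : Type*} [Fintype V] (N : Network M V) (n : ℕ) (s : V) (v : V)

/-- Low contention around `v` and little expected interference from far away. -/
def CalmRound (ρ ρ₁ b : ℝ) (h : List (Outcome V)) : Prop :=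
  N.vicinityContention ρ₁ (txProbs N n s h) v ≤ b ∧
  N.farWeight ρ (txProbs N n s h) v ≤ 1 / 8 * M.Icd ∧
  N.farWeight ρ₁ (txProbs N n s h) v ≤ 1 / 2 * M.clearThreshold

open Classical in
/-- Indicator of the rounds that are not calm. -/
noncomputable def unrest (ρ ρ₁ b : ℝ) (h : List (Outcome V)) : ℝ :=
  if CalmRound N n s v ρ ρ₁ b h then 0 else 1

open Classical in
/-- Potential of a running node `v`; it is `0` if `v` is not running. -/
noncomputable def potential (κ ρ : ℝ) (h : List (Outcome V)) : ℝ :=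
  if ∃ p, state N n s h v = .running p then
    txProbs N n s h v ^ (-(4 * κ / Real.log 2)) * 2 ^ activePacking N n s ρ v h
  else 0

variable {N n s v}

/-- With `e^κ = 1 + x` and `0 ≤ x ≤ 1/10` the claim becomes `3 + (1+x)^8 ≤ 4(1+x)^3`, and `4 + 12x`
lies between the two sides. -/
theorem exp_drift {κ : ℝ} (h0 : 0 ≤ κ) (h : κ ≤ 1 / 20) :
    3 / 4 * Real.exp (-(4 * κ)) + (1 - 3 / 4) * Real.exp (4 * κ) ≤ Real.exp (-κ) := by
  have hz1 : 1 ≤ Real.exp κ := Real.one_le_exp h0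
  have hz2 : Real.exp κ ≤ 11 / 10 := by
    have h1 : 1 - κ ≤ Real.exp (-κ) := Real.one_sub_le_exp_neg κ
    have h2 : Real.exp κ * Real.exp (-κ) = 1 := by rw [← Real.exp_add]; simp
    nlinarith
  have e1 : Real.exp (4 * κ) = Real.exp κ ^ 4 := by
    rw [← Real.exp_nat_mul]
    norm_num
  rw [Real.exp_neg, Real.exp_neg, e1]
  generalize Real.exp κ = z at hz1 hz2
  obtain ⟨x, rfl⟩ : ∃ x, z = 1 + x := ⟨z - 1, by ring⟩
  have hx0 : 0 ≤ x := by linarith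
  have hx1 : x ≤ 1 / 10 := by linarith
  have h2 : (1 + x) ^ 2 ≤ 1 + 21 / 10 * x := by nlinarith
  have h4 : (1 + x) ^ 4 ≤ 1 + 93 / 20 * x := by
    have : (1 + x) ^ 4 = ((1 + x) ^ 2) ^ 2 := by ring
    rw [this]
    refine (pow_le_pow_left₀ (by positivity) h2 2).trans ?_
    nlinarith
  have h8 : (1 + x) ^ 8 ≤ 1 + 12 * x := by
    have : (1 + x) ^ 8 = ((1 + x) ^ 4) ^ 2 := by ring
    rw [this]
    refine (pow_le_pow_left₀ (by positivity) h4 2).trans ?_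
    nlinarith
  have h3 : 1 + 3 * x ≤ (1 + x) ^ 3 := by nlinarith [pow_nonneg hx0 3, sq_nonneg x]
  have hz : (0 : ℝ) < 1 + x := by linarith
  have key : (3 + (1 + x) ^ 8) / (4 * (1 + x) ^ 4) ≤ (4 * (1 + x) ^ 3) / (4 * (1 + x) ^ 4) := by
    gcongr
    linarith
  refine le_trans (le_of_eq ?_) (key.trans (le_of_eq ?_)) <;> field_simp
  ring

/-- The exponent in the potential is normalized so that doubling or halving the transmission
probability changes it by exactly `exp(∓4κ)`. -/
theorem rpow_two_eq_exp (κ : ℝ) : (2 : ℝ) ^ (4 * κ / Real.log 2) = Real.exp (4 * κ) := by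
  have : Real.log 2 ≠ 0 := (Real.log_pos (by norm_num)).ne'
  rw [Real.rpow_def_of_pos two_pos]
  congr 1
  field_simp

theorem potential_of_running {κ ρ : ℝ} {h : List (Outcome V)} {p : ℝ}
    (hp : state N n s h v = .running p) : potential N n s v κ ρ h =
      p ^ (-(4 * κ / Real.log 2)) * 2 ^ activePacking N n s ρ v h := by
  rw [potential, if_pos ⟨p, hp⟩, txProbs, hp, NodeState.txProb]

theorem potential_nonneg (κ ρ : ℝ) (hn : 2 ≤ n) (h : List (Outcome V)) :
    0 ≤ potential N n s v κ ρ h := by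
  rw [potential]
  split_ifs
  · have := Real.rpow_nonneg (txProbs_nonneg N s hn h v) (-(4 * κ / Real.log 2))
    positivity
  · exact le_rfl

/-- Change of the potential in one round: it grows at most by the factor `exp (4κ)`, it is half of
that if a separated node is lost, and it shrinks by the factor `exp (-4κ)` if a channel
is idle and the transmission probability is small. -/
theorem potential_cons_le {κ ρ : ℝ} (hκ : 0 ≤ κ) (hn : 2 ≤ n) {h : List (Outcome V)} {p : ℝ}
    (hp : state N n s h v = .running p) (o : Outcome V) :
    potential N n s v κ ρ (o :: h) ≤ Real.exp (4 * κ) * potential N n s v κ ρ h ∧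
    (activePacking N n s ρ v (o :: h) + 1 ≤ activePacking N n s ρ v h →
      potential N n s v κ ρ (o :: h) ≤ 1 / 2 * (Real.exp (4 * κ) * potential N n s v κ ρ h)) ∧
    (v ∉ o.busy → p ≤ 1 / 4 →
      potential N n s v κ ρ (o :: h) ≤ Real.exp (-(4 * κ)) * potential N n s v κ ρ h) := by
  obtain ⟨hp1, hp2⟩ := state_running_bounds N s hn h v p hp
  have hp0 : 0 < p := lt_of_lt_of_le (by positivity) hp1
  have hθ : 0 ≤ 4 * κ / Real.log 2 :=
    div_nonneg (by linarith) (Real.log_pos (by norm_num)).le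
  have hpot := potential_nonneg (N := N) (s := s) (v := v) κ ρ hn h
  by_cases hrun : ∃ p', state N n s (o :: h) v = .running p'
  · obtain ⟨p', hp'⟩ := hrun
    obtain ⟨q, hq, hq'⟩ := running_of_cons N s
      (show (state N n s h v).Informed by rw [hp]; simp [NodeState.Informed]) hp'
    rw [hp] at hq
    cases hq
    have hm := activePacking_cons_le (N := N) (n := n) (s := s) (ρ := ρ) (v := v) o h
    have hpow : (2 : ℝ) ^ activePacking N n s ρ v (o :: h) ≤ 2 ^ activePacking N n s ρ v h :=
      pow_le_pow_right₀ (by norm_num) hm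
    have hhalf : 1 / 2 * p ≤ p' := hq' ▸ half_le_adjust n _ hp0.le hp2
    have hr1 : p' ^ (-(4 * κ / Real.log 2)) ≤
        Real.exp (4 * κ) * p ^ (-(4 * κ / Real.log 2)) := by
      refine (Real.rpow_le_rpow_of_nonpos (by linarith) hhalf (by linarith)).trans_eq ?_
      rw [Real.mul_rpow (by norm_num) hp0.le, one_div, Real.inv_rpow zero_le_two,
        Real.rpow_neg zero_le_two, inv_inv, rpow_two_eq_exp]
    rw [potential_of_running hp, potential_of_running hp']
    refine ⟨?_, fun hlost => ?_, fun hidle hp4 => ?_⟩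
    · rw [← mul_assoc]
      exact mul_le_mul hr1 hpow (by positivity) (by positivity)
    · have hpow' : (2 : ℝ) ^ activePacking N n s ρ v (o :: h) ≤
          1 / 2 * 2 ^ activePacking N n s ρ v h := by
        have := pow_le_pow_right₀ (one_le_two (α := ℝ)) hlost
        rw [pow_succ] at this
        linarith
      calc _ ≤ Real.exp (4 * κ) * p ^ (-(4 * κ / Real.log 2)) *
            (1 / 2 * 2 ^ activePacking N n s ρ v h) :=
            mul_le_mul hr1 hpow' (by positivity) (by positivity)
        _ = _ := by ring
    · have hdouble : p' = 2 * p := by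
        rw [hq', adjust_idle n hidle, min_eq_left (by linarith)]
      have hr2 : p' ^ (-(4 * κ / Real.log 2)) =
          Real.exp (-(4 * κ)) * p ^ (-(4 * κ / Real.log 2)) := by
        rw [hdouble, Real.mul_rpow zero_le_two hp0.le, Real.rpow_neg zero_le_two, rpow_two_eq_exp,
          Real.exp_neg]
      rw [hr2, ← mul_assoc]
      exact mul_le_mul_of_nonneg_left hpow (by positivity)
  · have h0 : potential N n s v κ ρ (o :: h) = 0 := by rw [potential, if_neg hrun]
    rw [h0]
    exact ⟨by positivity, fun _ => by positivity, fun _ _ => by positivity⟩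

variable {ρ ρ₁ b η κ : ℝ} {h : List (Outcome V)} {μ : PMF (Outcome V)}

/-- The potential shrinks in expectation in a calm round and grows at most by a constant factor in
any other one. -/
theorem expect_potential_le (hn : 2 ≤ n) (hμ : AdmissibleRound N ρ (txProbs N n s h) μ)
    (hρ : 0 < ρ) (h2ρ : 2 * ρ ≤ ρ₁) (hρc : ρ + M.rhoc (M.ε / 2) ≤ ρ₁)
    (hη0 : 0 < η) (hη4 : η ≤ 1 / 4) (hη : 7 / 8 ≤ M.h2 ^ (-η))
    (hκ0 : 0 ≤ κ) (hκ1 : κ ≤ 1 / 20) (hκ2 : 10 * κ ≤ 1 / 2 * η * Real.exp (-(2 * b)))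
    (hrun : ∃ p, state N n s h v = .running p) :
    expect μ (fun o => ENNReal.ofReal (potential N n s v κ ρ (o :: h))) ≤
      ENNReal.ofReal (Real.exp (-κ + 5 * κ * unrest N n s v ρ ρ₁ b h) *
        potential N n s v κ ρ h) := by
  classical
  obtain ⟨p, hp⟩ := hrun
  have hstep := potential_cons_le (ρ := ρ) hκ0 hn hp
  have hpot := potential_nonneg (N := N) (s := s) (v := v) κ ρ hn h
  by_cases hcalm : CalmRound N n s v ρ ρ₁ b h
  swap
  · refine expect_le_of_le fun o _ => ENNReal.ofReal_le_ofReal ((hstep o).1.trans_eq ?_)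
    rw [unrest, if_neg hcalm]
    congr 2
    ring
  rw [unrest, if_pos hcalm, mul_zero, add_zero]
  obtain ⟨hb, hfar, hfar₁⟩ := hcalm
  have hp0 := txProbs_nonneg N s hn h
  have hp2 := txProbs_le_half N s hn h
  rcases le_or_gt (N.vicinityContention ρ (txProbs N n s h) v) η with hlow | hhigh
  · have hpη : p ≤ 1 / 4 := by
      have h1 : txProbs N n s h v ≤ N.vicinityContention ρ (txProbs N n s h) v :=
        Finset.single_le_sum (f := txProbs N n s h) (fun w _ => hp0 w)
          (Finset.mem_filter.2 ⟨Finset.mem_univ v, N.mem_vicinity_self hρ v⟩)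
      rw [txProbs, hp, NodeState.txProb] at h1
      linarith
    -- Far interference is below `Icd` with probability at least `7/8`, and Idle then has
    -- conditional probability at least `7/8`; `(7/8)² ≥ 3/4`.
    have hq : 3 / 4 ≤ prob μ {o | v ∉ o.busy ∧ N.farInterference ρ o.tx v < M.Icd} := by
      refine le_trans ?_ (hμ.cd_idle v η hη0 hlow)
      have h1 := hμ.le_prob_farInterference_lt hp0 ρ v M.Icd_pos hfar
      have h2 : (7 / 8 : ℝ) ≤ prob μ {o | N.farInterference ρ o.tx v < M.Icd} := by linarith
      exact le_trans (by norm_num) (mul_le_mul hη h2 (by norm_num) (le_trans (by norm_num) hη))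
    refine (expect_le_of_prob_le (by positivity) ?_ hq (fun o _ ho => (hstep o).2.2 ho.1 hpη)
      fun o _ => (hstep o).1).trans (ENNReal.ofReal_le_ofReal ?_)
    · exact mul_le_mul_of_nonneg_right (Real.exp_le_exp.2 (by linarith)) hpot
    · have := mul_le_mul_of_nonneg_right (exp_drift hκ0 hκ1) hpot
      linarith
  · have hDU : (Finset.univ.filter fun w => w ∈ N.vicinity v ρ) ⊆
        Finset.univ.filter fun w => w ∈ N.vicinity v ρ₁ := by
      intro w hw
      rw [Finset.mem_filter] at hw ⊢
      exact ⟨hw.1, lt_of_lt_of_le hw.2 (mul_le_mul_of_nonneg_right (by linarith) M.R_pos.le)⟩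
    have hq := hμ.le_prob_unique_transmitter hp0 hp2 hDU (g := fun w => N.signal w v)
      (fun w => N.signal_nonneg w v) M.clearThreshold_pos
      (le_trans (le_of_eq (by rw [Network.farWeight]; exact Finset.sum_congr (by simp) fun _ _ => rfl))
        hfar₁) hhigh.le hb
    refine (expect_le_of_prob_le (A := 1 / 2 * (Real.exp (4 * κ) * potential N n s v κ ρ h))
      (by positivity) ?_ hq ?_ fun o _ => (hstep o).1).trans (ENNReal.ofReal_le_ofReal ?_)
    · have : 0 ≤ Real.exp (4 * κ) * potential N n s v κ ρ h := by positivity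
      linarith
    · rintro o ho ⟨u, hu, htx, hI⟩
      have hu' : u ∈ N.vicinity v ρ := (Finset.mem_filter.1 hu).2
      refine (hstep o).2.1 (activePacking_cons_lt hu' ?_ fun w hw =>
        stopped_of_unique_transmitter hn hμ ho hρ h2ρ hρc hu' htx hI hw)
      intro hst
      refine hμ.ne_zero_of_mem_tx ho ((htx u (hDU hu)).2 rfl) ?_
      rw [txProbs, hst, NodeState.txProb]
    -- The expected factor is at most `(1 - c/2) exp(4κ)`, and `1 - c/2 ≤ exp(-5κ)` because `10κ ≤
    -- c`.
    · set c := 1 / 2 * η * Real.exp (-(2 * b)) with hc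
      have h1 : 1 - c / 2 ≤ Real.exp (-(5 * κ)) := by
        refine le_trans ?_ (Real.exp_le_exp.2 (show -(c / 2) ≤ -(5 * κ) by linarith))
        linarith [Real.add_one_le_exp (-(c / 2))]
      have h2 : Real.exp (-κ) = Real.exp (-(5 * κ)) * Real.exp (4 * κ) := by
        rw [← Real.exp_add]
        congr 1
        ring
      have h3 : 0 ≤ Real.exp (4 * κ) * potential N n s v κ ρ h := by positivity
      rw [h2, mul_assoc]
      nlinarith [mul_le_mul_of_nonneg_right h1 h3]

end Drift

/-! # Progress of a single node -/

section Progress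

variable {M : Model} {V : Type*} [Fintype V] {N : Network M V} {n : ℕ} {s v : V}
  {ρ ρ₁ b η κ : ℝ} {env : List (Outcome V) → PMF (Outcome V)}

theorem potential_le (hn : 2 ≤ n) (hρ : 0 ≤ ρ) (hκ : 0 ≤ κ) (h : List (Outcome V)) :
    potential N n s v κ ρ h ≤
      (2 * n : ℝ) ^ (4 * κ / Real.log 2) * 2 ^ M.packBound (ρ * M.R) := by
  have hθ : 0 ≤ 4 * κ / Real.log 2 :=
    div_nonneg (by linarith) (Real.log_pos (by norm_num)).le
  have hn0 : (0 : ℝ) < n := by positivity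
  rw [potential]
  split_ifs with hrun
  · obtain ⟨p, hp⟩ := hrun
    rw [txProbs, hp, NodeState.txProb, ← Real.rpow_natCast]
    refine mul_le_mul ?_ ?_ (by positivity) (by positivity)
    · refine (Real.rpow_le_rpow_of_nonpos (by positivity) (state_running_bounds N s hn h v p hp).1
        (by linarith)).trans_eq ?_
      rw [show 1 / 2 * (n : ℝ)⁻¹ = (2 * n : ℝ)⁻¹ by rw [mul_inv, one_div],
        Real.inv_rpow (by positivity), Real.rpow_neg (by positivity), inv_inv]
    · exact Real.rpow_le_rpow_of_exponent_le one_le_two (activePacking_le hρ h)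
  · positivity

theorem one_le_potential (hn : 2 ≤ n) (hκ : 0 ≤ κ) {h : List (Outcome V)}
    (hrun : ∃ p, state N n s h v = .running p) : 1 ≤ potential N n s v κ ρ h := by
  have hθ : 0 ≤ 4 * κ / Real.log 2 :=
    div_nonneg (by linarith) (Real.log_pos (by norm_num)).le
  obtain ⟨p, hp⟩ := hrun
  obtain ⟨hp1, hp2⟩ := state_running_bounds N s hn h v p hp
  rw [potential_of_running hp]
  exact one_le_mul_of_one_le_of_one_le
    (Real.one_le_rpow_of_pos_of_le_one_of_nonpos (lt_of_lt_of_le (by positivity) hp1)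
      (by linarith) (by linarith)) (one_le_pow₀ one_le_two)

/-- A node does not run for long, unless there are many rounds that are not calm. -/
theorem prob_running_le (hn : 2 ≤ n) (hex : IsExecution N ρ n s env)
    (hρ : 0 < ρ) (h2ρ : 2 * ρ ≤ ρ₁) (hρc : ρ + M.rhoc (M.ε / 2) ≤ ρ₁)
    (hη0 : 0 < η) (hη4 : η ≤ 1 / 4) (hη : 7 / 8 ≤ M.h2 ^ (-η))
    (hκ0 : 0 ≤ κ) (hκ1 : κ ≤ 1 / 20) (hκ2 : 10 * κ ≤ 1 / 2 * η * Real.exp (-(2 * b)))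
    (T L : ℕ) :
    prob (law env (T + L)) {h | (state N n s (h.drop L) v).Informed ∧
        (∃ p, state N n s h v = .running p) ∧
        windowSum (unrest N n s v ρ ρ₁ b) L h ≤ 1 / 10 * L} ≤
      (2 * n : ℝ) ^ (4 * κ / Real.log 2) * 2 ^ M.packBound (ρ * M.R) /
        Real.exp (1 / 2 * κ * L) := by
  classical
  set W := windowSum (unrest N n s v ρ ρ₁ b) with hW
  -- The exponent compensates the drift `-κ + 5κ * unrest` round by round. The indicator fixes that
  -- `v` was informed when the window began, so `v` cannot be asleep later.
  have h1 := expect_law_add_le env T (fun τ h => if (state N n s (h.drop τ) v).Informed then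
    ENNReal.ofReal (Real.exp (κ * τ - 5 * κ * W τ h) * potential N n s v κ ρ h) else 0) (by
      intro τ h hh
      by_cases hi : (state N n s (h.drop τ) v).Informed
      swap
      · simp [hi, expect_const]
      simp only [List.drop_succ_cons, hi, if_true]
      cases hst : state N n s h v with
      | asleep => exact absurd hst (informed_of_drop N s τ h hi)
      | stopped =>
        refine expect_le_of_le fun o _ => ?_
        have : potential N n s v κ ρ (o :: h) = 0 := by
          rw [potential, stopped_cons N s hst o]
          simp
        simp [this]
      | running p =>
        have e : ∀ o, Real.exp (κ * (τ + 1 : ℕ) - 5 * κ * W (τ + 1) (o :: h)) =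
            Real.exp (κ * (τ + 1 : ℕ) - 5 * κ * (unrest N n s v ρ ρ₁ b h + W τ h)) := by
          intro o
          rw [hW, windowSum_succ_cons]
        simp only [e, ENNReal.ofReal_mul (Real.exp_pos _).le]
        rw [expect_const_mul]
        refine (mul_le_mul_right (expect_potential_le hn (hex _ h hh) hρ h2ρ hρc hη0 hη4 hη hκ0
          hκ1 hκ2 ⟨p, hst⟩) _).trans_eq ?_
        rw [← ENNReal.ofReal_mul (Real.exp_pos _).le, ← ENNReal.ofReal_mul (Real.exp_pos _).le,
          ← mul_assoc, ← Real.exp_add]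
        congr 3
        push_cast
        ring) L
  refine prob_le_div (Real.exp_pos _) (by positivity) ?_ (h1.trans (expect_le_of_le fun h _ => ?_))
  · rintro h - ⟨hi, hrun, hw⟩
    rw [if_pos hi]
    refine ENNReal.ofReal_le_ofReal ?_
    have h2 := one_le_potential (N := N) (s := s) (ρ := ρ) hn hκ0 hrun
    have h3 := mul_le_mul_of_nonneg_left hw (show 0 ≤ 5 * κ by linarith)
    -- At most `L/10` rounds that are not calm cost `5κ * L/10`, half of the gain `κL`.
    have h4 : Real.exp (1 / 2 * κ * L) ≤ Real.exp (κ * L - 5 * κ * W L h) :=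
      Real.exp_le_exp.2 (by linarith)
    exact h4.trans (le_mul_of_one_le_right (Real.exp_pos _).le h2)
  · split_ifs
    · refine ENNReal.ofReal_le_ofReal ?_
      simpa [hW] using potential_le hn hρ.le hκ0 h
    · exact bot_le

/-- In a round that is not calm one of the three ratios exceeds `1`. The indicator is thus replaced
by a linear function of the probabilities, which can be summed over time. -/
theorem unrest_le (hn : 2 ≤ n) (hb : 0 < b) (h : List (Outcome V)) :
    unrest N n s v ρ ρ₁ b h ≤ N.vicinityContention ρ₁ (txProbs N n s h) v / b +
      N.farWeight ρ (txProbs N n s h) v / (1 / 8 * M.Icd) +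
      N.farWeight ρ₁ (txProbs N n s h) v / (1 / 2 * M.clearThreshold) := by
  have hp0 := txProbs_nonneg N s hn h
  have hI : 0 < 1 / 8 * M.Icd := by linarith [M.Icd_pos]
  have ht : 0 < 1 / 2 * M.clearThreshold := by linarith [M.clearThreshold_pos]
  have h1 : 0 ≤ N.vicinityContention ρ₁ (txProbs N n s h) v / b :=
    div_nonneg (Finset.sum_nonneg fun w _ => hp0 w) hb.le
  have h2 : ∀ ρ', 0 ≤ N.farWeight ρ' (txProbs N n s h) v := fun ρ' =>
    Finset.sum_nonneg fun w _ => mul_nonneg (hp0 w) (N.signal_nonneg w v)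
  have h3 := div_nonneg (h2 ρ) hI.le
  have h4 := div_nonneg (h2 ρ₁) ht.le
  rw [unrest]
  split_ifs with hc
  · linarith
  · by_contra! hlt
    refine hc ⟨?_, ?_, ?_⟩
    · exact ((div_le_one hb).1 (by linarith))
    · exact ((div_le_one hI).1 (by linarith))
    · exact ((div_le_one ht).1 (by linarith))

/-- Most rounds are calm if the average contention of all close neighbourhoods is bounded. -/
theorem windowSum_unrest_le (hn : 2 ≤ n) (hb : 0 < b) (hρ : 1 ≤ ρ) (hρ₁ : 1 ≤ ρ₁)
    (hvic : 30 * (M.packBound (ρ₁ * M.R) * M.avgContention) ≤ b)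
    (hfar : 240 * (M.farConst * (ρ * M.R) ^ (M.growth - M.ζ) * M.avgContention) ≤ M.Icd)
    (hfar₁ : 60 * (M.farConst * (ρ₁ * M.R) ^ (M.growth - M.ζ) * M.avgContention) ≤
      M.clearThreshold)
    {L : ℕ} {h : List (Outcome V)}
    (hcont : ∀ x, windowSum (contention N n s x) L h ≤ M.avgContention * L) :
    windowSum (unrest N n s v ρ ρ₁ b) L h ≤ 1 / 10 * L := by
  classical
  -- By linearity the sum over the window is taken first; the geometric bounds then need only the
  -- time averages of the contentions.
  set q : V → ℝ := fun w => ∑ i ∈ Finset.range L, txProbs N n s (h.drop (i + 1)) w with hq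
  have hq0 : ∀ w, 0 ≤ q w := fun w => Finset.sum_nonneg fun i _ => txProbs_nonneg N s hn _ w
  have hqc : ∀ x, N.closeContention q x ≤ M.avgContention * L := by
    intro x
    refine le_trans (le_of_eq ?_) (hcont x)
    rw [Network.closeContention, hq, Finset.sum_comm]
    rfl
  have hI := M.Icd_pos
  have ht := M.clearThreshold_pos
  have hL : (0 : ℝ) ≤ L := Nat.cast_nonneg L
  have evic : ∑ i ∈ Finset.range L, N.vicinityContention ρ₁ (txProbs N n s (h.drop (i + 1))) v =
      N.vicinityContention ρ₁ q v := by
    simp only [Network.vicinityContention]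
    rw [Finset.sum_comm]
  have efar : ∀ ρ', ∑ i ∈ Finset.range L, N.farWeight ρ' (txProbs N n s (h.drop (i + 1))) v =
      N.farWeight ρ' q v := by
    intro ρ'
    simp only [Network.farWeight]
    rw [Finset.sum_comm]
    exact Finset.sum_congr rfl fun w _ => by rw [hq, Finset.sum_mul]
  refine (windowSum_mono (unrest_le hn hb) L h).trans ?_
  rw [windowSum, Finset.sum_add_distrib, Finset.sum_add_distrib, ← Finset.sum_div,
    ← Finset.sum_div, ← Finset.sum_div, evic, efar, efar]
  -- Each of the three terms gets the share `L/30`; hence `30`, `240 = 30 * 8` and `60 = 30 * 2` in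
  -- the hypotheses.
  have h1 : N.vicinityContention ρ₁ q v / b ≤ 1 / 30 * L := by
    rw [div_le_iff₀ hb]
    have h2 := N.vicinityContention_le hq0 hqc (by linarith : 0 ≤ ρ₁) v
    have h3 := mul_le_mul_of_nonneg_right hvic hL
    linarith
  have h2 : N.farWeight ρ q v / (1 / 8 * M.Icd) ≤ 1 / 30 * L := by
    rw [div_le_iff₀ (by linarith)]
    have h2 := N.farWeight_le hq0 hqc hρ v
    have h3 := mul_le_mul_of_nonneg_right hfar hL
    linarith
  have h3 : N.farWeight ρ₁ q v / (1 / 2 * M.clearThreshold) ≤ 1 / 30 * L := by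
    rw [div_le_iff₀ (by linarith)]
    have h2 := N.farWeight_le hq0 hqc hρ₁ v
    have h3 := mul_le_mul_of_nonneg_right hfar₁ hL
    linarith
  linarith

end Progress

/-! # Choice of the constants -/

section Constants

theorem Model.exists_far_small (M : Model) {δ : ℝ} (hδ : 0 < δ) :
    ∃ r₀ : ℝ, ∀ ρ, r₀ ≤ ρ →
      M.farConst * (ρ * M.R) ^ (M.growth - M.ζ) * M.avgContention ≤ δ := by
  have h1 : Filter.Tendsto (fun ρ : ℝ => M.farConst * (ρ * M.R) ^ (M.growth - M.ζ) *
      M.avgContention) Filter.atTop (nhds (M.farConst * 0 * M.avgContention)) := by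
    refine Filter.Tendsto.mul_const _ (Filter.Tendsto.const_mul _ ?_)
    have h2 := (tendsto_rpow_neg_atTop (sub_pos.2 M.growth_lt_ζ)).comp
      (Filter.tendsto_id.atTop_mul_const M.R_pos)
    simpa [Function.comp_def] using h2
  rw [mul_zero, zero_mul] at h1
  obtain ⟨r₀, hr₀⟩ := Filter.eventually_atTop.1 (h1.eventually (gt_mem_nhds hδ))
  exact ⟨r₀, fun ρ hρ => (hr₀ ρ hρ).le⟩

theorem Model.exists_idle_contention (M : Model) :
    ∃ η : ℝ, 0 < η ∧ η ≤ 1 / 4 ∧ 7 / 8 ≤ M.h2 ^ (-η) := by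
  have hlog : 0 < Real.log M.h2 := Real.log_pos M.one_lt_h2
  refine ⟨min (1 / 4) (Real.log (8 / 7) / Real.log M.h2), lt_min (by norm_num)
    (div_pos (Real.log_pos (by norm_num)) hlog), min_le_left _ _, ?_⟩
  have h1 : Real.log M.h2 * min (1 / 4) (Real.log (8 / 7) / Real.log M.h2) ≤ Real.log (8 / 7) := by
    refine (mul_le_mul_of_nonneg_left (min_le_right _ _) hlog.le).trans_eq ?_
    field_simp
  rw [Real.rpow_def_of_pos (by linarith [M.one_lt_h2]), mul_neg]
  refine le_trans (le_of_eq ?_) (Real.exp_le_exp.2 (neg_le_neg h1))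
  rw [Real.exp_neg, Real.exp_log (by norm_num)]
  norm_num

theorem log_two_le_log {n : ℕ} (hn : 2 ≤ n) : Real.log 2 ≤ Real.log n :=
  Real.log_le_log two_pos (by exact_mod_cast hn)

theorem le_div_log_two_mul_log {n : ℕ} (hn : 2 ≤ n) {a : ℝ} (ha : 0 ≤ a) :
    a ≤ a / Real.log 2 * Real.log n := by
  have h2 : 0 < Real.log 2 := Real.log_pos (by norm_num)
  rw [div_mul_eq_mul_div, le_div_iff₀ h2]
  exact mul_le_mul_of_nonneg_left (log_two_le_log hn) ha

/-- An error that decays exponentially in the number of rounds is polynomially small after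
`O(log n)` rounds. -/
theorem exists_error_le {A B θ κ : ℝ} (hA : 0 ≤ A) (hB : 0 ≤ B) (hθ : 0 ≤ θ) (hκ : 0 < κ) {k : ℝ}
    (hk : 0 < k) : ∃ K : ℝ, 0 < K ∧ ∀ n : ℕ, 2 ≤ n → ∀ L : ℝ, K * Real.log n ≤ L →
      n * Real.exp (A - L) + (2 * n : ℝ) ^ θ * 2 ^ B / Real.exp (κ * L) ≤ (n : ℝ) ^ (-k) := by
  have h2 : 0 < Real.log 2 := Real.log_pos (by norm_num)
  -- The two groups of summands make the two error terms at most `n^(-k-1)` each, and `2 ≤ n`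
  -- absorbs their sum.
  refine ⟨(2 + k + A / Real.log 2) + (1 + k + 2 * θ + B) / κ, by positivity, fun n hn L hL => ?_⟩
  have hl := log_two_le_log hn
  have hl0 : 0 < Real.log n := h2.trans_le hl
  have hn0 : (0 : ℝ) < n := by positivity
  have hAl := le_div_log_two_mul_log hn hA
  have hgoal : (n : ℝ) ^ (-k) = Real.exp (-(k * Real.log n)) := by
    rw [Real.rpow_def_of_pos hn0]
    congr 1
    ring
  have hhalf : 2 * Real.exp (-(k * Real.log n) - Real.log n) ≤ Real.exp (-(k * Real.log n)) := by
    nth_rewrite 1 [← Real.exp_log two_pos]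
    rw [← Real.exp_add]
    exact Real.exp_le_exp.2 (by linarith)
  have ht1 : n * Real.exp (A - L) ≤ Real.exp (-(k * Real.log n) - Real.log n) := by
    nth_rewrite 1 [← Real.exp_log hn0]
    rw [← Real.exp_add]
    refine Real.exp_le_exp.2 ?_
    have : 0 ≤ (1 + k + 2 * θ + B) / κ * Real.log n := by positivity
    linarith
  have ht2 : (2 * n : ℝ) ^ θ * 2 ^ B / Real.exp (κ * L) ≤
      Real.exp (-(k * Real.log n) - Real.log n) := by
    rw [Real.rpow_def_of_pos (by positivity), Real.rpow_def_of_pos two_pos, ← Real.exp_add,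
      ← Real.exp_sub, Real.log_mul (by norm_num) hn0.ne']
    refine Real.exp_le_exp.2 ?_
    have h3 : (1 + k + 2 * θ + B) * Real.log n ≤ κ * L := by
      have h4 : (1 + k + 2 * θ + B) / κ * Real.log n ≤ L := by
        have : 0 ≤ (2 + k + A / Real.log 2) * Real.log n := by positivity
        linarith
      have := mul_le_mul_of_nonneg_left h4 hκ.le
      rwa [← mul_assoc, mul_div_cancel₀ _ hκ.ne'] at this
    have h5 := mul_le_mul_of_nonneg_right hl hθ
    have h6 := mul_le_mul_of_nonneg_right hl hB
    linarith
  rw [hgoal]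
  linarith

end Constants

/-! ### Progress along one edge -/

section Progress

/-- Within `O(log n)` rounds, all neighbours of an informed node are informed. -/
theorem exists_progress.{u} (M : Model) : ∃ ρ₀ : ℝ, 1 < ρ₀ ∧ ∀ ρ : ℝ, ρ₀ ≤ ρ → ∀ k : ℝ, 0 < k →
    ∃ K : ℝ, 0 < K ∧ ∀ (V : Type u) [Fintype V] (N : Network M V) (n : ℕ), Fintype.card V ≤ n →
      2 ≤ n → ∀ (s : V) (env : List (Outcome V) → PMF (Outcome V)), IsExecution N ρ n s env →
      ∀ v, ∀ w ∈ N.nbhd v M.ε, ∀ T L : ℕ, K * Real.log n ≤ L →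
        prob (law env (T + L)) {h | (state N n s (h.drop L) v).Informed ∧
          ¬ (state N n s h w).Informed} ≤ (n : ℝ) ^ (-k) := by
  have hR := M.R_pos
  obtain ⟨r₀, hr₀⟩ := M.exists_far_small (show 0 < M.Icd / 240 by linarith [M.Icd_pos])
  obtain ⟨r₁, hr₁⟩ := M.exists_far_small
    (show 0 < M.clearThreshold / 60 by linarith [M.clearThreshold_pos])
  obtain ⟨η, hη0, hη4, hη⟩ := M.exists_idle_contention
  refine ⟨max 2 r₀, lt_max_of_lt_left one_lt_two, fun ρ hρ k hk => ?_⟩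
  have hρ2 : 2 ≤ ρ := (le_max_left _ _).trans hρ
  -- The choices are not circular: `avgContention` and `η` depend on the model only, `ρ₁` also on
  -- `ρ`, then `b` on `ρ₁`, and `κ` on `b` and `η`.
  set ρ₁ := max (2 * ρ) (max (ρ + M.rhoc (M.ε / 2)) r₁) with hρ₁def
  have h2ρ : 2 * ρ ≤ ρ₁ := le_max_left _ _
  have hρc : ρ + M.rhoc (M.ε / 2) ≤ ρ₁ := (le_max_left _ _).trans (le_max_right _ _)
  have hr₁ρ : r₁ ≤ ρ₁ := (le_max_right _ _).trans (le_max_right _ _)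
  set b := 30 * (M.packBound (ρ₁ * M.R) * M.avgContention) + 1 with hbdef
  have hb : 0 < b := by
    have := mul_nonneg (M.packBound_nonneg (show 0 ≤ ρ₁ * M.R by
      exact mul_nonneg (by linarith) hR.le)) M.avgContention_pos.le
    linarith
  set κ := min (1 / 20) (1 / 20 * η * Real.exp (-(2 * b))) with hκdef
  have hκ0 : 0 < κ := lt_min (by norm_num) (by positivity)
  have hκ2 : 10 * κ ≤ 1 / 2 * η * Real.exp (-(2 * b)) := by
    have : κ ≤ 1 / 20 * η * Real.exp (-(2 * b)) := min_le_right _ _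
    linarith
  have hγ : 0 ≤ 2 * M.momentGrowth := by linarith [M.momentRate_pos, M.momentRate_le]
  obtain ⟨K, hK, herr⟩ := exists_error_le hγ
    (M.packBound_nonneg (show 0 ≤ ρ * M.R from mul_nonneg (by linarith) hR.le))
    (show 0 ≤ 4 * κ / Real.log 2 from
      div_nonneg (by linarith) (Real.log_pos (by norm_num)).le) (half_pos hκ0) hk
  refine ⟨K, hK, fun V _ N n hcard hn s env hex v w hw T L hL => ?_⟩
  refine le_trans ?_ (herr n hn L hL)
  -- Either some close neighbourhood has excessive average contention, or `v` is still running
  -- although most rounds were calm.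
  refine (prob_mono (F := {h | ∃ x ∈ Finset.univ, h ∈ {h : List (Outcome V) |
    M.avgContention * L < windowSum (contention N n s x) L h}} ∪
    {h | (state N n s (h.drop L) v).Informed ∧ (∃ p, state N n s h v = .running p) ∧
        windowSum (unrest N n s v ρ ρ₁ b) L h ≤ 1 / 10 * L}) ?_).trans
    ((prob_union_le _ _ _).trans (add_le_add ?_ ?_))
  · rintro h hh ⟨hi, hwi⟩
    by_cases hc : ∀ x, windowSum (contention N n s x) L h ≤ M.avgContention * L
    · refine Or.inr ⟨hi, ?_, ?_⟩
      · have hi' := informed_of_drop N s L h hi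
        cases hst : state N n s h v with
        | asleep => exact absurd hst hi'
        | running p => exact ⟨p, rfl⟩
        | stopped => exact absurd (informed_of_stopped hn hex _ h hh v hst w hw) hwi
      · refine windowSum_unrest_le hn hb (by linarith) (by linarith) (by linarith) ?_ ?_ hc
        · have := hr₀ ρ ((le_max_right _ _).trans hρ)
          linarith
        · have := hr₁ ρ₁ hr₁ρ
          linarith
    · push Not at hc
      obtain ⟨x, hx⟩ := hc
      exact Or.inl ⟨x, Finset.mem_univ x, hx⟩
  · refine (prob_exists_le _ _ _).trans ((Finset.sum_le_card_nsmul _ _ _ fun x _ =>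
      prob_windowSum_contention_le hn hcard hex x T L).trans ?_)
    rw [nsmul_eq_mul]
    exact mul_le_mul_of_nonneg_right (by exact_mod_cast hcard) (Real.exp_pos _).le
  · refine (prob_running_le hn hex (by linarith) h2ρ hρc hη0 hη4 hη hκ0.le (min_le_left _ _) hκ2
      T L).trans_eq ?_
    congr 2
    ring

end Progress

/-! # Hop distances -/

section HopDistance

variable {V : Type*} {G : Digraph V} {s v : V}

theorem hopDist_le {k : ℕ} (h : HasWalk G k s v) : hopDist G s v ≤ k := iInf₂_le k h

theorem exists_hopDist_eq (h : ∃ k, HasWalk G k s v) :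
    ∃ k, HasWalk G k s v ∧ hopDist G s v = k := by
  classical
  refine ⟨Nat.find h, Nat.find_spec h, le_antisymm (hopDist_le (Nat.find_spec h)) ?_⟩
  exact le_iInf₂ fun k hk => by exact_mod_cast Nat.find_min' h hk

theorem exists_walk_of_hopDist_ne_top (h : hopDist G s v ≠ ⊤) : ∃ k, HasWalk G k s v := by
  by_contra! hcon
  exact h (by simp [hopDist, hcon])

/-- The nodes at smaller hop distance exist. -/
theorem exists_hopDist_eq_of_le : ∀ (k : ℕ) (v : V), HasWalk G k s v → hopDist G s v = k →
    ∀ i ≤ k, ∃ x, hopDist G s x = i := by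
  intro k
  induction k with
  | zero =>
    intro v _ hk i hi
    exact ⟨v, by rw [hk, Nat.le_zero.1 hi]⟩
  | succ k ih =>
    intro v hv hk i hi
    rcases Nat.lt_or_ge i (k + 1) with hlt | hge
    · cases hv with
      | snoc hu huv =>
        rename_i u
        refine ih u hu (le_antisymm (hopDist_le hu) ?_) i (by omega)
        obtain ⟨j, hj, hju⟩ := exists_hopDist_eq ⟨k, hu⟩
        have h1 := hopDist_le (hj.snoc huv)
        rw [hk] at h1
        have h2 : k + 1 ≤ j + 1 := by exact_mod_cast h1
        rw [hju]
        exact_mod_cast Nat.le_of_succ_le_succ h2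
    · exact ⟨v, by rw [hk, le_antisymm hi hge]⟩

/-- Every distance below `k` is attained, by distinct nodes for distinct distances. -/
theorem hopDist_le_card [Fintype V] {k : ℕ} (hv : HasWalk G k s v) (hk : hopDist G s v = k) :
    k ≤ Fintype.card V := by
  choose x hx using fun i : Fin k => exists_hopDist_eq_of_le k v hv hk i i.2.le
  have hinj : Function.Injective x := fun i j hij => by
    have := hx i
    rw [hij, hx j] at this
    exact Fin.ext (by exact_mod_cast this.symm)
  simpa using Fintype.card_le_of_injective x hinj

end HopDistance

/-! # Broadcast -/

section Broadcast

variable {M : Model} {V : Type*} {N : Network M V} {n : ℕ} {s : V}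
  {env : List (Outcome V) → PMF (Outcome V)}

theorem prob_uninformed_antitone {t t' : ℕ} (h : t ≤ t') (v : V) :
    prob (law env t') {h | ¬ (state N n s h v).Informed} ≤
      prob (law env t) {h | ¬ (state N n s h v).Informed} := by
  obtain ⟨τ, rfl⟩ := Nat.exists_eq_add_of_le h
  exact (prob_mono (E := {h | ¬ (state N n s h v).Informed})
    (F := {h | h.drop τ ∈ {h | ¬ (state N n s h v).Informed}})
    fun h _ hh hi => hh (informed_of_drop N s τ h hi)).trans (prob_law_drop_le env t τ _)

/-- Each edge gets its own window of `L` rounds and adds one error `q`. -/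
theorem prob_uninformed_le_of_walk {q : ℝ} {L : ℕ}
    (hstep : ∀ v, ∀ w ∈ N.nbhd v M.ε, ∀ T : ℕ, prob (law env (T + L))
      {h | (state N n s (h.drop L) v).Informed ∧ ¬ (state N n s h w).Informed} ≤ q)
    {j : ℕ} {v : V} (hwalk : HasWalk N.commGraph j s v) :
    prob (law env (j * L)) {h | ¬ (state N n s h v).Informed} ≤ j * q := by
  generalize hs : s = s' at hwalk
  induction hwalk with
  | nil u =>
    subst hs
    rw [prob_eq_zero]
    · simp
    · intro h hh
      simp only [zero_mul, law, PMF.support_pure, Set.mem_singleton_iff] at hh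
      subst hh
      simp [state, NodeState.Informed]
  | @snoc j u v w hwalk hadj ih =>
    subst hs
    have h1 := ih rfl
    have h2 := hstep v w hadj (j * L)
    rw [Nat.succ_mul]
    refine (prob_mono (F := {h | h.drop L ∈ {h | ¬ (state N n s h v).Informed}} ∪
      {h | (state N n s (h.drop L) v).Informed ∧ ¬ (state N n s h w).Informed}) ?_).trans
      ((prob_union_le _ _ _).trans ?_)
    · intro h _ hh
      by_cases hi : (state N n s (h.drop L) v).Informed
      · exact Or.inr ⟨hi, hh⟩
      · exact Or.inl hi
    · have h3 := (prob_law_drop_le env (j * L) L {h | ¬ (state N n s h v).Informed}).trans h1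
      push_cast
      linarith

end Broadcast
end Wireless

/-! ### Union bounds over hops and nodes -/

theorem mainTheorem5 (M : Wireless.Model) :
    ∃ ρ₀ : ℝ, 1 < ρ₀ ∧ ∀ ρ : ℝ, ρ₀ ≤ ρ → ∀ k : ℝ, 0 < k → ∃ K : ℝ, 0 < K ∧
      ∀ (V : Type*) [Fintype V] (N : Wireless.Network M V) (n : ℕ), Fintype.card V ≤ n →
      ∀ (s : V) (env : List (Wireless.Outcome V) → PMF (Wireless.Outcome V)),
        Wireless.IsExecution N ρ n s env →
        (∀ v : V, Wireless.hopDist N.commGraph s v ≠ ⊤ →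
          ∀ t : ℕ, K * Real.log n * (Wireless.hopDist N.commGraph s v).toNat ≤ t →
            1 - (n : ℝ) ^ (-k) ≤
              Wireless.prob (Wireless.law env t)
                {h | (Wireless.state N n s h v).Informed}) ∧
        (Wireless.StronglyConnected N.commGraph →
          ∀ t : ℕ, K * Real.log n * (Wireless.diameter N.commGraph).toNat ≤ t →
            1 - (n : ℝ) ^ (-k) ≤
              Wireless.prob (Wireless.law env t)
                {h | ∀ v : V, (Wireless.state N n s h v).Informed}) := by
  obtain ⟨ρ₀, hρ₀, H⟩ := Wireless.exists_progress M
  refine ⟨ρ₀, hρ₀, fun ρ hρ k hk => ?_⟩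
  -- One factor `n` is lost to the at most `n` hops of a path, another to the union bound over the
  -- nodes.
  obtain ⟨K, hK, H⟩ := H ρ hρ (k + 2) (by linarith)
  have hlog2 : 0 < Real.log 2 := Real.log_pos (by norm_num)
  -- The extra `1 / log 2` absorbs rounding `K log n` up to an integer, as `log n ≥ log 2`.
  refine ⟨K + 1 / Real.log 2, by positivity, fun V _ N n hcard s env hex => ?_⟩
  have hn1 : 1 ≤ n := (Fintype.card_pos_iff.2 ⟨s⟩).trans_le hcard
  rcases Nat.lt_or_ge n 2 with hlt | hn
  -- For `n = 1` the claimed lower bounds are `0`.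
  · obtain rfl : n = 1 := by omega
    simp only [Nat.cast_one, Real.one_rpow, sub_self]
    exact ⟨fun _ _ _ _ => Wireless.prob_nonneg _ _, fun _ _ _ => Wireless.prob_nonneg _ _⟩
  have hn0 : (0 : ℝ) < n := by positivity
  have hln : 0 < Real.log n := hlog2.trans_le (Wireless.log_two_le_log hn)
  have hpow : ∀ a : ℝ, n * (n : ℝ) ^ (-(a + 1)) = (n : ℝ) ^ (-a) := fun a => by
    nth_rewrite 1 [← Real.rpow_one (n : ℝ)]
    rw [← Real.rpow_add hn0]
    congr 1
    ring
  have key : ∀ v (D : ℕ), Wireless.HasWalk N.commGraph D s v →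
      Wireless.hopDist N.commGraph s v = D → ∀ t : ℕ, (K + 1 / Real.log 2) * Real.log n * D ≤ t →
      Wireless.prob (Wireless.law env t) {h | ¬ (Wireless.state N n s h v).Informed} ≤
        (n : ℝ) ^ (-(k + 1)) := by
    intro v D hwalk hD t ht
    set L := ⌈K * Real.log n⌉₊ with hL
    have hLn : (L : ℝ) ≤ (K + 1 / Real.log 2) * Real.log n := by
      have h1 := Nat.ceil_lt_add_one (mul_nonneg hK.le hln.le)
      have h2 := Wireless.le_div_log_two_mul_log hn zero_le_one
      rw [hL]
      linarith
    have hDt : D * L ≤ t := by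
      have h1 := mul_le_mul_of_nonneg_right hLn (Nat.cast_nonneg (α := ℝ) D)
      have h2 : (D * L : ℝ) ≤ t := by linarith
      exact_mod_cast h2
    have hDn : (D : ℝ) ≤ n := by exact_mod_cast (Wireless.hopDist_le_card hwalk hD).trans hcard
    refine (Wireless.prob_uninformed_antitone hDt v).trans ((Wireless.prob_uninformed_le_of_walk
      (fun v w hw T => H V N n hcard hn s env hex v w hw T L (Nat.le_ceil _)) hwalk).trans ?_)
    rw [← hpow (k + 1), show k + 1 + 1 = k + 2 by ring]
    exact mul_le_mul_of_nonneg_right hDn (by positivity)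
  constructor
  · intro v hv t ht
    obtain ⟨D, hwalk, hD⟩ :=
      Wireless.exists_hopDist_eq (Wireless.exists_walk_of_hopDist_ne_top hv)
    rw [hD, ENat.toNat_natCast] at ht
    have h1 := key v D hwalk hD t ht
    have h2 := Wireless.prob_add_prob_compl (Wireless.law env t)
      {h | (Wireless.state N n s h v).Informed}
    have h3 : (n : ℝ) ^ (-(k + 1)) ≤ (n : ℝ) ^ (-k) :=
      Real.rpow_le_rpow_of_exponent_le (by exact_mod_cast hn1) (by linarith)
    have h4 : {h | (Wireless.state N n s h v).Informed}ᶜ =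
      {h | ¬ (Wireless.state N n s h v).Informed} := rfl
    rw [h4] at h2
    linarith
  · intro hconn t ht
    -- Needed because `toNat` sends `⊤` to `0`; an infinite diameter would make the hypothesis on
    -- `t` void.
    have hdiam : Wireless.diameter N.commGraph ≠ ⊤ := by
      refine ne_top_of_le_ne_top (ENat.natCast_ne_top (Fintype.card V)) (iSup₂_le fun u v => ?_)
      obtain ⟨D, hwalk, hD⟩ := Wireless.exists_hopDist_eq (hconn u v)
      rw [hD]
      exact_mod_cast Wireless.hopDist_le_card hwalk hD
    have h1 : Wireless.prob (Wireless.law env t)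
        {h | ∃ v ∈ Finset.univ, h ∈ {h | ¬ (Wireless.state N n s h v).Informed}} ≤
        (n : ℝ) ^ (-k) := by
      refine (Wireless.prob_exists_le _ _ _).trans ((Finset.sum_le_card_nsmul _ _
        ((n : ℝ) ^ (-(k + 1))) fun v _ => ?_).trans ?_)
      · obtain ⟨D, hwalk, hD⟩ := Wireless.exists_hopDist_eq (hconn s v)
        refine key v D hwalk hD t (le_trans ?_ ht)
        refine mul_le_mul_of_nonneg_left ?_ (by positivity)
        have h2 : (D : ℕ∞) ≤ Wireless.diameter N.commGraph :=
          hD ▸ le_iSup₂ (f := fun u v => Wireless.hopDist N.commGraph u v) s v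
        exact_mod_cast ENat.toNat_le_toNat h2 hdiam
      · rw [nsmul_eq_mul, ← hpow k]
        exact mul_le_mul_of_nonneg_right (by exact_mod_cast hcard) (by positivity)
    have h2 := Wireless.prob_add_prob_compl (Wireless.law env t)
      {h | ∀ v : V, (Wireless.state N n s h v).Informed}
    have h4 : {h | ∀ v : V, (Wireless.state N n s h v).Informed}ᶜ =
        {h | ∃ v ∈ Finset.univ, h ∈ {h | ¬ (Wireless.state N n s h v).Informed}} := by
      ext h
      simp
    rw [h4] at h2
    linarith
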